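/- Let $n\ge 0$ be an integer and $\lambda>0$. For $z,w\in\mathbb C^n$ write $z\cdot w=\sum_j z_jw_j$ (bilinear) and $|z|^2=\sum_j|z_j|^2$. Let $\mathcal F_\lambda$ be the Fock space of all holomorphic functions $f$ on $\mathbb C^n$ with $$\|f\|^2=\int_{\mathbb C^n}|f(z)|^2\,d\gamma_\lambda(z)<\infty,\qquad d\gamma_\lambda(z)=(2\pi)^{-n}\lambda^n e^{-\lambda|z|^2/2}\,dm(z),$$ where $dm$ is Lebesgue measure on $\mathbb C^n$, with the corresponding inner product. Let $S=Sp(n,\mathbb C)\cap SU(n,n)$; its elements are the matrices $$k=\begin{pmatrix}P&Q\\ \bar Q&\bar P\end{pmatrix},\qquad P,Q\in M_n(\mathbb C),\quad PP^*-QQ^*=I_n,\quad PQ^t=QP^t,$$ and $P$ is invertible for each of them. For $k\in S$ and $z,w\in\mathbb C^n$ put $$b_k(z,w)=(\operatorname{Det}P)^{-1/2}\exp\Big(\tfrac{\lambda}{4}\big(z\cdot(\bar QP^{-1}z)+2(P^{-1}z)\cdot\bar w-\bar w\cdot(P^{-1}Q\bar w)\big)\Big),$$ with the principal determination of the square root,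 and let $\sigma(k)$ be the operator on $\mathcal F_\lambda$ with kernel $b_k$, that is, $$(\sigma(k)f)(z)=\int_{\mathbb C^n}b_k(z,w)f(w)\,d\gamma_\lambda(w).$$ Then the integral converges absolutely for all $k\in S$, $f\in\mathcal F_\lambda$ and $z\in\mathbb C^n$, and $\sigma(k)$ maps $\mathcal F_\lambda$ to itself. Moreover: 1. For all $k,k'\in S$, $\sigma(kk')=\sigma(k)\sigma(k')$ or $\sigma(kk')=-\sigma(k)\sigma(k')$. 2. For each $k\in S$, $\sigma(k)$ is unitary, i.e. a surjective linear isometry of $\mathcal F_\lambda$. Consequently $\sigma$ is a projective (two-valued) representation of $S$: the map $k\mapsto\{\sigma(k),-\sigma(k)\}$ is a group homomorphism from $S$ to the quotient of the unitary group of $\mathcal F_\lambda$ by $\{1,-1\}$. -/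

import Mathlib

open MeasureTheory
open scoped Matrix ComplexConjugate

noncomputable section

/-! ### The Fock space -/

/-- The Gaussian measure `(2π)⁻ⁿ lamⁿ exp(-lam |z|² / 2) dm(z)` on `ℂⁿ`, where `dm` is Lebesgue
measure and `|z|² = ∑ |z_j|²`. -/
def fockMeasure (n : ℕ) (lam : ℝ) : Measure (Fin n → ℂ) :=
  (volume : Measure (Fin n → ℂ)).withDensity fun z =>
    ENNReal.ofReal ((2 * Real.pi)⁻¹ ^ n * lam ^ n * Real.exp (-(lam / 2) * ∑ j, ‖z j‖ ^ 2))

/-- The entire functions on `ℂⁿ` that are square integrable for the Gaussian measure. -/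
def fockSubmodule (n : ℕ) (lam : ℝ) : Submodule ℂ ((Fin n → ℂ) → ℂ) where
  carrier := {f | Differentiable ℂ f ∧ MemLp f 2 (fockMeasure n lam)}
  add_mem' hf hg := ⟨hf.1.add hg.1, hf.2.add hg.2⟩
  zero_mem' := ⟨differentiable_const 0, MemLp.zero⟩
  smul_mem' c _ hf := ⟨hf.1.const_smul c, hf.2.const_smul c⟩

/-- The Fock space with parameter `lam > 0`. -/
def FockSpace (n : ℕ) (lam : ℝ) (_hlam : 0 < lam) : Type := fockSubmodule n lam

namespace FockSpace

variable {n : ℕ} {lam : ℝ} {hlam : 0 < lam}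

instance : AddCommGroup (FockSpace n lam hlam) :=
  inferInstanceAs (AddCommGroup (fockSubmodule n lam))

instance : Module ℂ (FockSpace n lam hlam) :=
  inferInstanceAs (Module ℂ (fockSubmodule n lam))

instance : FunLike (FockSpace n lam hlam) (Fin n → ℂ) ℂ where
  coe f := Subtype.val (p := fun g => g ∈ fockSubmodule n lam) f
  coe_injective := Subtype.val_injective

theorem ext {f g : FockSpace n lam hlam} (h : ∀ z, f z = g z) : f = g :=
  DFunLike.ext f g h

theorem differentiable (f : FockSpace n lam hlam) : Differentiable ℂ f := f.2.1

theorem memLp (f : FockSpace n lam hlam) : MemLp f 2 (fockMeasure n lam) := f.2.2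

theorem integrable_inner (f g : FockSpace n lam hlam) :
    Integrable (fun z => conj (f z) * g z) (fockMeasure n lam) :=
  MemLp.integrable_mul (MemLp.star f.memLp) g.memLp

theorem ae_volume_of_ae {p : (Fin n → ℂ) → Prop} (hlam : 0 < lam)
    (h : ∀ᵐ z ∂(fockMeasure n lam), p z) : ∀ᵐ z, p z := by
  rw [fockMeasure, ae_withDensity_iff (by fun_prop)] at h
  filter_upwards [h] with z hz
  refine hz ?_
  have : 0 < (2 * Real.pi)⁻¹ ^ n * lam ^ n * Real.exp (-(lam / 2) * ∑ j, ‖z j‖ ^ 2) := by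
    positivity
  simpa using this

/-- The inner product `∫ conj (f z) g z`, against the Gaussian measure (conjugate linear in the
first variable, as everywhere in Mathlib). -/
instance innerCore : InnerProductSpace.Core ℂ (FockSpace n lam hlam) where
  inner f g := ∫ z, conj (f z) * g z ∂(fockMeasure n lam)
  conj_inner_symm f g := by
    rw [← integral_conj]
    refine integral_congr_ae (Filter.Eventually.of_forall fun z => ?_)
    simp [mul_comm]
  re_inner_nonneg f := by
    have h : ∀ z, conj (f z) * f z = ((‖f z‖ ^ 2 : ℝ) : ℂ) := fun z => by
      rw [RCLike.conj_mul]; norm_cast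
    simp_rw [h]
    rw [integral_complex_ofReal, RCLike.re_to_complex, Complex.ofReal_re]
    exact integral_nonneg fun z => by positivity
  add_left f g h := by
    rw [← integral_add (integrable_inner f h) (integrable_inner g h)]
    refine integral_congr_ae (Filter.Eventually.of_forall fun z => ?_)
    change conj (f z + g z) * h z = _
    rw [map_add, add_mul]
  smul_left f g c := by
    rw [← integral_const_mul]
    refine integral_congr_ae (Filter.Eventually.of_forall fun z => ?_)
    change conj (c * f z) * g z = _
    rw [map_mul, mul_assoc]
  definite f hf := by
    have h : ∀ z, conj (f z) * f z = ((‖f z‖ ^ 2 : ℝ) : ℂ) := fun z => by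
      rw [RCLike.conj_mul]; norm_cast
    have hi : Integrable (fun z => ‖f z‖ ^ 2) (fockMeasure n lam) := by
      have := (integrable_inner f f).norm
      refine this.congr (Filter.Eventually.of_forall fun z => ?_)
      simp [pow_two]
    simp_rw [h] at hf
    rw [integral_complex_ofReal] at hf
    have h0 : ∫ z, ‖f z‖ ^ 2 ∂(fockMeasure n lam) = 0 := by exact_mod_cast hf
    rw [integral_eq_zero_iff_of_nonneg (fun z => by positivity) hi] at h0
    have h1 : ∀ᵐ z, f z = 0 := by
      refine ae_volume_of_ae hlam (h0.mono fun z hz => ?_)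
      simpa using hz
    have h2 : (f : (Fin n → ℂ) → ℂ) = fun _ => 0 :=
      Continuous.ae_eq_iff_eq volume f.differentiable.continuous continuous_const |>.1 h1
    exact ext fun z => congrFun h2 z

instance : NormedAddCommGroup (FockSpace n lam hlam) := innerCore.toNormedAddCommGroup

instance : InnerProductSpace ℂ (FockSpace n lam hlam) := InnerProductSpace.ofCore innerCore.toCore

theorem inner_def (f g : FockSpace n lam hlam) :
    inner ℂ f g = ∫ z, conj (f z) * g z ∂(fockMeasure n lam) := rfl

end FockSpace

/-! ### The group `S = Sp(n, ℂ) ∩ SU(n, n)` -/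

/-- The Hermitian form `diag(I, -I)` of signature `(n, n)`. -/
def hermForm (n : ℕ) : Matrix (Fin n ⊕ Fin n) (Fin n ⊕ Fin n) ℂ :=
  Matrix.fromBlocks 1 0 0 (-1)

/-- The group `S = Sp(n, ℂ) ∩ SU(n, n)`, as a subgroup of `Sp(n, ℂ)`. -/
def groupS (n : ℕ) : Subgroup (Matrix.symplecticGroup (Fin n) ℂ) where
  carrier := {g | g.1ᴴ * hermForm n * g.1 = hermForm n ∧ g.1.det = 1}
  mul_mem' {a b} ha hb := by
    refine ⟨?_, ?_⟩
    · calc (a.1 * b.1)ᴴ * hermForm n * (a.1 * b.1)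
          = b.1ᴴ * (a.1ᴴ * hermForm n * a.1) * b.1 := by
            simp only [Matrix.conjTranspose_mul, Matrix.mul_assoc]
        _ = hermForm n := by rw [ha.1, hb.1]
    · change (a.1 * b.1).det = 1
      rw [Matrix.det_mul, ha.2, hb.2, one_mul]
  one_mem' := ⟨by simp, by simp⟩
  inv_mem' {a} ha := by
    have h1 : a.1 * (a⁻¹).1 = 1 := congrArg Subtype.val (mul_inv_cancel a)
    refine ⟨?_, ?_⟩
    · calc ((a⁻¹).1)ᴴ * hermForm n * (a⁻¹).1
          = ((a⁻¹).1)ᴴ * (a.1ᴴ * hermForm n * a.1) * (a⁻¹).1 := by rw [ha.1]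
        _ = (a.1 * (a⁻¹).1)ᴴ * hermForm n * (a.1 * (a⁻¹).1) := by
            simp only [Matrix.conjTranspose_mul, Matrix.mul_assoc]
        _ = hermForm n := by rw [h1]; simp
    · have := congrArg Matrix.det h1
      rwa [Matrix.det_mul, ha.2, one_mul, Matrix.det_one] at this

namespace groupS

variable {n : ℕ}

/-- The upper left block `P` of `k`. -/
def blockP (k : groupS n) : Matrix (Fin n) (Fin n) ℂ := k.1.1.toBlocks₁₁

/-- The upper right block `Q` of `k`. -/
def blockQ (k : groupS n) : Matrix (Fin n) (Fin n) ℂ := k.1.1.toBlocks₁₂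

theorem hermForm_mul_self (n : ℕ) : hermForm n * hermForm n = 1 := by
  simp [hermForm, Matrix.fromBlocks_multiply]

/-- `k` has the block form `(P, Q; Q̄, P̄)`. -/
theorem eq_fromBlocks (k : groupS n) :
    k.1.1 = Matrix.fromBlocks (blockP k) (blockQ k)
      ((blockQ k).map conj) ((blockP k).map conj) := by
  set L := hermForm n with hL
  set J := Matrix.J (Fin n) ℂ with hJ
  have hLL : L * L = 1 := hermForm_mul_self n
  have h1 : (L * k.1.1ᴴ * L) * k.1.1 = 1 := by
    rw [Matrix.mul_assoc, Matrix.mul_assoc, ← Matrix.mul_assoc k.1.1ᴴ, k.2.1, hLL]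
  have h2 : (-J) * k.1.1ᵀ * J * k.1.1 = 1 := by
    have := SymplecticGroup.inv_left_mul_aux k.1.2
    simpa using this
  have h3 : L * k.1.1ᴴ * L = (-J) * k.1.1ᵀ * J :=
    (Matrix.inv_eq_left_inv h1).symm.trans (Matrix.inv_eq_left_inv h2)
  have hb : k.1.1 = Matrix.fromBlocks (blockP k) (blockQ k) k.1.1.toBlocks₂₁ k.1.1.toBlocks₂₂ :=
    (Matrix.fromBlocks_toBlocks _).symm
  rw [hb] at h3
  simp only [hL, hJ, hermForm, Matrix.J, Matrix.fromBlocks_conjTranspose,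
    Matrix.fromBlocks_transpose, Matrix.fromBlocks_multiply, Matrix.fromBlocks_neg] at h3
  have h4 := Matrix.fromBlocks_inj.1 h3
  obtain ⟨h5, h6, -, -⟩ := h4
  have h7 : k.1.1.toBlocks₂₂ = (blockP k).map conj := by
    have := congrArg Matrix.transpose h5
    simp at this
    rw [← this]; rfl
  have h8 : k.1.1.toBlocks₂₁ = (blockQ k).map conj := by
    have := congrArg Matrix.transpose h6
    simp at this
    rw [← this]
    ext i j
    simp
  rw [← h7, ← h8]; exact hb

theorem P_mul_sub (k : groupS n) :
    blockP k * (blockP k)ᴴ - blockQ k * (blockQ k)ᴴ = 1 := by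
  have hLL := hermForm_mul_self n
  have h1 : (hermForm n * k.1.1ᴴ * hermForm n) * k.1.1 = 1 := by
    rw [Matrix.mul_assoc, Matrix.mul_assoc, ← Matrix.mul_assoc k.1.1ᴴ, k.2.1, hLL]
  have h2 := mul_eq_one_comm.1 h1
  have h3 : k.1.1 * hermForm n * k.1.1ᴴ = hermForm n := by
    calc k.1.1 * hermForm n * k.1.1ᴴ
        = (k.1.1 * (hermForm n * k.1.1ᴴ * hermForm n)) * hermForm n := by
          simp only [Matrix.mul_assoc, hLL, Matrix.mul_one]
      _ = hermForm n := by rw [h2, Matrix.one_mul]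
  rw [eq_fromBlocks] at h3
  simp only [hermForm, Matrix.fromBlocks_conjTranspose, Matrix.fromBlocks_multiply] at h3
  have := (Matrix.fromBlocks_inj.1 h3).1
  simpa [sub_eq_add_neg] using this

theorem P_mul_transpose (k : groupS n) :
    blockP k * (blockQ k)ᵀ = blockQ k * (blockP k)ᵀ := by
  have h := SymplecticGroup.mem_iff.1 k.1.2
  rw [eq_fromBlocks] at h
  simp only [Matrix.J, Matrix.fromBlocks_transpose, Matrix.fromBlocks_multiply] at h
  have := (Matrix.fromBlocks_inj.1 h).1
  simp at this
  rw [add_neg_eq_zero] at this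
  exact this.symm

open scoped ComplexOrder in
/-- `P` is invertible, so that `P⁻¹` and `(Det P)^{-1/2}` have their usual meaning. -/
theorem det_P_ne_zero (k : groupS n) : (blockP k).det ≠ 0 := by
  have h1 : blockP k * (blockP k)ᴴ = 1 + blockQ k * (blockQ k)ᴴ := by
    rw [← P_mul_sub k]; abel
  have h2 : (blockP k * (blockP k)ᴴ).PosDef := by
    rw [h1]
    exact Matrix.PosDef.one.add_posSemidef (Matrix.posSemidef_self_mul_conjTranspose _)
  intro h0
  have := h2.det_pos
  rw [Matrix.det_mul, h0, zero_mul] at this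
  exact lt_irrefl _ this

end groupS

/-! ### The metaplectic kernel -/

/-- The Gaussian kernel `b_k(z, w)`, with the principal branch of `(Det P)^{-1/2}`; `Q̄` is the
entrywise conjugate of `Q`. -/
def metaplecticKernel {n : ℕ} (lam : ℝ) (k : groupS n) (z w : Fin n → ℂ) : ℂ :=
  (groupS.blockP k).det ^ (-(1 / 2) : ℂ) *
    Complex.exp ((lam / 4 : ℂ) *
      (z ⬝ᵥ (((groupS.blockQ k).map conj * (groupS.blockP k)⁻¹) *ᵥ z) + 2 * (((groupS.blockP k)⁻¹ *ᵥ z) ⬝ᵥ star w)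
        - star w ⬝ᵥ (((groupS.blockP k)⁻¹ * groupS.blockQ k) *ᵥ star w)))

/-- The subgroup `{1, -1}` of the unitary group of the Fock space. -/
def signSubgroup (n : ℕ) (lam : ℝ) (hlam : 0 < lam) :
    Subgroup (FockSpace n lam hlam ≃ₗᵢ[ℂ] FockSpace n lam hlam) where
  carrier := {1, LinearIsometryEquiv.neg ℂ}
  mul_mem' {a b} ha hb := by
    rcases ha with rfl | rfl <;> rcases hb with rfl | rfl
    · left; rfl
    · right; rfl
    · right; rfl
    · left; ext1 f; exact neg_neg f
  one_mem' := Or.inl rfl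
  inv_mem' {a} ha := by
    rcases ha with rfl | rfl
    · left; rfl
    · right; rfl

instance (n : ℕ) (lam : ℝ) (hlam : 0 < lam) : (signSubgroup n lam hlam).Normal where
  conj_mem a ha g := by
    rcases ha with rfl | rfl
    · left; simp
    · right
      ext1 f
      change g (-(g⁻¹ f)) = -f
      rw [map_neg]
      exact congrArg Neg.neg (g.apply_symm_apply f)

end

/-! The exponent of `b_k` is a generating function of the linear map `k`: if `k` sends `(r, w̄)` to
`(z, y)`, it equals `(lam / 4) (z·y + w̄·r)` (`groupS.phase_eq`). Composing two kernels is a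
Gaussian integral. It converges because `Q̄P⁻¹` and `P⁻¹Q` are symmetric strict contractions, and
its value is read off at the critical point of the exponent, where the two generating functions
combine into that of `kk'`. The prefactors agree up to a factor of square 1, because the Gaussian
constant `c` satisfies `c² det(1 - AB) = 1` and `det P det P' det(1 - AB)` is the determinant of the
`P`-block of `kk'`. Hence `b_k` composed with `b_k'` is `± b_kk'`, with a sign that does not depend
on `z` and `w` (`exists_integral_metaplecticKernel_mul`). Likewise `conj b_k(w, z) = ± b_{k⁻¹}(z,
w)`.

Unitarity follows from Hilbert space arguments. The vectors `e_{k,z} = conj b_k(z, ·)` lie in the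
Fock space, which gives absolute convergence, and `e_{1,z}` is the reproducing kernel, so the
`e_{1,z}` have dense span. The kernel identities give `⟨e_{k,z}, e_{k,z'}⟩ = ± ⟨e_{1,z}, e_{1,z'}⟩`,
and positivity excludes the minus sign. By completeness, `e_{1,z} ↦ e_{k,z}` extends to an isometry
`T_k`. Then `σ(k)` is the adjoint of `T_k`; it sends `e_{k',w}` to `± e_{k'k⁻¹,w}`, so `σ(k) = ±
T_{k⁻¹}` is itself isometric, and `T_k* T_k = 1` makes it onto. The product rule is checked on the
vectors `e_{1,z}`. -/

/-! ### Gaussian integrals over real space with complex symmetric matrices. -/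

section RealGaussian

variable {ι : Type*} [Fintype ι] [DecidableEq ι]

open scoped MatrixOrder in
/-- Two real quadratic forms, the first of them positive definite, are simultaneously
diagonalizable. -/
theorem exists_simultaneous_diagonalization {H K : Matrix ι ι ℝ} (hH : H.PosDef)
    (hK : K.IsHermitian) :
    ∃ (C : Matrix ι ι ℝ) (d : ι → ℝ), C.det ≠ 0 ∧ H = Cᵀ * C ∧
      K = Cᵀ * Matrix.diagonal d * C := by
  obtain ⟨B, hB⟩ : ∃ B : Matrix ι ι ℝ, H = Bᵀ * B := by
    obtain ⟨B, hB⟩ := CStarAlgebra.nonneg_iff_eq_star_mul_self.mp hH.posSemidef.nonneg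
    exact ⟨B, by rw [hB, Matrix.star_eq_conjTranspose, Matrix.conjTranspose_eq_transpose_of_trivial]⟩
  have hdet : IsUnit B.det := by
    have h := hH.det_pos
    rw [hB, Matrix.det_mul] at h
    exact isUnit_iff_ne_zero.2 fun h0 => by simp [h0] at h
  have hinv : B⁻¹ * B = 1 := Matrix.nonsing_inv_mul _ hdet
  have hinvT : Bᵀ * B⁻¹ᵀ = 1 := by rw [← Matrix.transpose_mul, hinv, Matrix.transpose_one]
  have hL : (B⁻¹ᵀ * K * B⁻¹).IsHermitian := by
    have h := Matrix.isHermitian_conjTranspose_mul_mul B⁻¹ hK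
    rwa [Matrix.conjTranspose_eq_transpose_of_trivial] at h
  set U : Matrix ι ι ℝ := hL.eigenvectorUnitary.1 with hU
  have hUU : U * Uᵀ = 1 := by
    have := Matrix.mem_unitaryGroup_iff.1 hL.eigenvectorUnitary.2
    rwa [Matrix.star_eq_conjTranspose, Matrix.conjTranspose_eq_transpose_of_trivial] at this
  have hspec : B⁻¹ᵀ * K * B⁻¹ = U * Matrix.diagonal hL.eigenvalues * Uᵀ := by
    have h := hL.spectral_theorem
    rw [Unitary.conjStarAlgAut_apply] at h
    exact h
  generalize hL.eigenvalues = d at hspec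
  -- `B` reduces `H` to the identity; the orthogonal `U` preserves this and diagonalizes the
  -- transported `K`.
  refine ⟨Uᵀ * B, d, ?_, ?_, ?_⟩
  · rw [Matrix.det_mul]
    refine mul_ne_zero (fun h0 => ?_) hdet.ne_zero
    have := congrArg Matrix.det hUU
    rw [Matrix.det_mul, h0, mul_zero, Matrix.det_one] at this
    exact zero_ne_one this
  · rw [hB, Matrix.transpose_mul, Matrix.transpose_transpose, Matrix.mul_assoc,
      ← Matrix.mul_assoc U, hUU, Matrix.one_mul]
  · calc K = Bᵀ * (B⁻¹ᵀ * K * B⁻¹) * B := by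
          simp only [Matrix.mul_assoc, hinv, Matrix.mul_one]
          rw [← Matrix.mul_assoc, hinvT, Matrix.one_mul]
      _ = _ := by
          rw [hspec, Matrix.transpose_mul, Matrix.transpose_transpose]
          simp only [Matrix.mul_assoc]

theorem integral_cexp_neg_mul_sq_sub {d : ℂ} (hd : 0 < d.re) (w : ℂ) :
    ∫ y : ℝ, Complex.exp (-d * (y - w) ^ 2) = (Real.pi / d) ^ (1 / 2 : ℂ) := by
  have h0 : d ≠ 0 := by rintro rfl; simp at hd
  have h := integral_cexp_quadratic (b := -d) (by simpa using hd) (2 * d * w) (-d * w ^ 2)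
  rw [neg_neg] at h
  calc _ = ∫ y : ℝ, Complex.exp (-d * y ^ 2 + 2 * d * w * y + -d * w ^ 2) := by
        congr 1 with y; ring_nf
    _ = _ := by
        rw [h]
        have : -d * w ^ 2 - (2 * d * w) ^ 2 / (4 * -d) = 0 := by field_simp; ring
        rw [this, Complex.exp_zero, mul_one]

/-- The Gaussian integral for a complex symmetric matrix with positive definite real part, with a
complex shift. -/
theorem exists_integral_cexp_neg_quadratic {M : Matrix ι ι ℂ} (hM : M.IsSymm)
    (hre : (M.map Complex.re).PosDef) :
    ∃ c : ℂ, c ^ 2 * M.det = (Real.pi : ℂ) ^ Fintype.card ι ∧ ∀ v : ι → ℂ,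
      ∫ x : ι → ℝ, Complex.exp
        (-(((fun i => (x i : ℂ)) - v) ⬝ᵥ (M *ᵥ ((fun i => (x i : ℂ)) - v)))) = c := by
  have him : (M.map Complex.im).IsHermitian := by
    ext i j
    simp [hM.apply i j]
  obtain ⟨C, d, hC, h1, h2⟩ := exists_simultaneous_diagonalization hre him
  -- With `Re M = CᵀC` and `Im M = Cᵀ diag(d) C`, `M` becomes `Cᵀ diag(1 + i d) C`. In the
  -- coordinates `Cx` the integral splits into one-variable Gaussians whose coefficients have real
  -- part 1.
  set D : ι → ℂ := fun i => 1 + d i * Complex.I with hD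
  have hDre : ∀ i, 0 < (D i).re := fun i => by simp [hD]
  have hD0 : ∀ i, D i ≠ 0 := fun i h => by simpa [h] using hDre i
  set C' : Matrix ι ι ℂ := C.map (algebraMap ℝ ℂ) with hC'
  have hMd : M = C'ᵀ * Matrix.diagonal D * C' := by
    ext i j
    have e1 := congrFun (congrFun h1 i) j
    have e2 := congrFun (congrFun h2 i) j
    rw [Matrix.map_apply, Matrix.mul_apply] at e1 e2
    simp only [Matrix.transpose_apply, Matrix.mul_diagonal] at e1 e2
    rw [← Complex.re_add_im (M i j), e1, e2, Matrix.mul_apply]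
    simp only [Matrix.mul_diagonal, hC', Matrix.transpose_apply,
      Matrix.map_apply, hD]
    push_cast
    rw [Finset.sum_mul, ← Finset.sum_add_distrib]
    refine Finset.sum_congr rfl fun l _ => ?_
    simp only [Complex.coe_algebraMap]
    ring
  have hdetC : C'.det = (C.det : ℂ) := by
    rw [hC', ← RingHom.mapMatrix_apply, ← RingHom.map_det]; rfl
  -- A product of principal roots need not be the principal root of the product, so only the square
  -- of the constant is recorded. A sign is all that this loses.
  refine ⟨(|C.det|⁻¹ : ℝ) * ∏ i, (Real.pi / D i : ℂ) ^ (1 / 2 : ℂ), ?_, fun v => ?_⟩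
  · have hsq : ∀ i, ((Real.pi / D i : ℂ) ^ (1 / 2 : ℂ)) ^ 2 = Real.pi / D i := fun i => by
      rw [← Complex.cpow_nat_mul]; norm_num
    rw [mul_pow, ← Finset.prod_pow, Finset.prod_congr rfl fun i _ => hsq i, Finset.prod_div_distrib,
      hMd, Matrix.det_mul, Matrix.det_mul, Matrix.det_transpose, Matrix.det_diagonal, hdetC,
      Finset.prod_const, Finset.card_univ]
    have h3 : (∏ i, D i) ≠ 0 := Finset.prod_ne_zero_iff.2 fun i _ => hD0 i
    have h4 : (C.det : ℂ) ≠ 0 := by exact_mod_cast hC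
    have h5 : ((|C.det|⁻¹ : ℝ) : ℂ) ^ 2 = ((C.det : ℂ) ^ 2)⁻¹ := by
      rw [← Complex.ofReal_pow, inv_pow, sq_abs]; push_cast; rfl
    rw [h5]
    field_simp
  · set w := C' *ᵥ v with hw
    set F : (ι → ℝ) → ℂ := fun y => ∏ i, Complex.exp (-D i * (y i - w i) ^ 2) with hF
    have hexp : ∀ x : ι → ℝ, Complex.exp
        (-(((fun i => (x i : ℂ)) - v) ⬝ᵥ (M *ᵥ ((fun i => (x i : ℂ)) - v))))
        = F (Matrix.toLin' C x) := fun x => by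
      rw [hF]
      simp only
      rw [← Complex.exp_sum]
      congr 1
      have hx : ∀ i, ((Matrix.toLin' C x i : ℝ) : ℂ) = (C' *ᵥ fun i => (x i : ℂ)) i := fun i => by
        simp [Matrix.toLin'_apply, Matrix.mulVec, dotProduct, hC']
      rw [hMd, ← Matrix.mulVec_mulVec, ← Matrix.mulVec_mulVec, Matrix.dotProduct_mulVec,
        Matrix.vecMul_transpose, Matrix.mulVec_sub, ← hw]
      simp only [dotProduct, Matrix.mulVec_diagonal, Pi.sub_apply, hx, ← Finset.sum_neg_distrib]
      exact Finset.sum_congr rfl fun i _ => by ring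
    simp_rw [hexp]
    have hFm : AEStronglyMeasurable F (Measure.map (Matrix.toLin' C) volume) := by
      have : Continuous F := by fun_prop
      exact this.aestronglyMeasurable
    have hcont : Continuous (Matrix.toLin' C) := LinearMap.continuous_of_finiteDimensional _
    rw [← integral_map hcont.aemeasurable hFm, Real.map_matrix_volume_pi_eq_smul_volume_pi hC,
      integral_smul_measure, hF,
      integral_fintype_prod_volume_eq_prod
        (f := fun i (y : ℝ) => Complex.exp (-D i * (y - w i) ^ 2)),
      Finset.prod_congr rfl fun i _ => integral_cexp_neg_mul_sq_sub (hDre i) (w i),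
      ENNReal.toReal_ofReal (abs_nonneg _), abs_inv, Complex.real_smul]

end RealGaussian

/-! ### Gaussian integrals for the Fock measure. -/

section FockGaussian

variable {n : ℕ}

theorem volume_preserving_re_im (n : ℕ) :
    MeasurePreserving (fun (x : Fin n ⊕ Fin n → ℝ) (j : Fin n) =>
      ((x (Sum.inl j) : ℂ) + x (Sum.inr j) * Complex.I)) := by
  have h1 := volume_measurePreserving_sumPiEquivProdPi (fun _ : Fin n ⊕ Fin n => ℝ)
  have h2 := (volume_measurePreserving_arrowProdEquivProdArrow ℝ ℝ (Fin n)).symm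
  have h3 := volume_preserving_pi
    (fun _ : Fin n => Complex.volume_preserving_equiv_real_prod.symm)
  have h4 := h3.comp (h2.comp h1)
  have h5 : (fun (x : Fin n ⊕ Fin n → ℝ) (j : Fin n) =>
      ((x (Sum.inl j) : ℂ) + x (Sum.inr j) * Complex.I)) =
      (fun a i => Complex.measurableEquivRealProd.symm (a i)) ∘
        (MeasurableEquiv.arrowProdEquivProdArrow ℝ ℝ (Fin n)).symm ∘
          (MeasurableEquiv.sumPiEquivProdPi fun _ => ℝ) := by
    ext x j
    apply Complex.ext <;> simp [MeasurableEquiv.sumPiEquivProdPi, Equiv.sumPiEquivProdPi,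
      MeasurableEquiv.arrowProdEquivProdArrow, Equiv.arrowProdEquivProdArrow,
      Complex.measurableEquivRealProd]
  rwa [h5]

theorem integral_pi_complex_eq (F : (Fin n → ℂ) → ℂ) (hF : Continuous F) :
    ∫ u, F u = ∫ x : Fin n ⊕ Fin n → ℝ,
      F fun j => (x (Sum.inl j) : ℂ) + x (Sum.inr j) * Complex.I := by
  have h := volume_preserving_re_im n
  rw [← h.map_eq, integral_map h.measurable.aemeasurable hF.aestronglyMeasurable]

theorem integral_fockMeasure {lam : ℝ} (hlam : 0 < lam) (F : (Fin n → ℂ) → ℂ) :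
    ∫ u, F u ∂(fockMeasure n lam) =
      ((lam / (2 * Real.pi)) ^ n : ℂ) * ∫ u, Complex.exp (-(lam / 2) * (u ⬝ᵥ star u)) * F u := by
  rw [fockMeasure, integral_withDensity_eq_integral_toReal_smul (by fun_prop) (by simp),
    ← integral_const_mul]
  refine integral_congr_ae (Filter.Eventually.of_forall fun u => ?_)
  have h : u ⬝ᵥ star u = ((∑ j, ‖u j‖ ^ 2 : ℝ) : ℂ) := by
    simp [dotProduct, Complex.mul_conj, Complex.normSq_eq_norm_sq]
  simp only [h]
  rw [ENNReal.toReal_ofReal (by positivity), Complex.real_smul]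
  push_cast
  rw [div_pow, mul_pow, inv_pow, mul_pow]
  field_simp

/-- Strict contractions for the Euclidean norm. -/
def IsStrictContraction (A : Matrix (Fin n) (Fin n) ℂ) : Prop :=
  ∀ u : Fin n → ℂ, u ≠ 0 → ∑ j, ‖(A *ᵥ u) j‖ ^ 2 < ∑ j, ‖u j‖ ^ 2

/-- Apply `ab ≤ (a² + b²) / 2` in each coordinate. This makes the real part of `2|u|² - u·Au - ū·Bū`
positive. -/
theorem IsStrictContraction.re_dotProduct_lt {A : Matrix (Fin n) (Fin n) ℂ}
    (hA : IsStrictContraction A) {u : Fin n → ℂ} (hu : u ≠ 0) :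
    (u ⬝ᵥ (A *ᵥ u)).re < ∑ j, ‖u j‖ ^ 2 := by
  have h1 : ∀ j, (u j * (A *ᵥ u) j).re ≤ (‖u j‖ ^ 2 + ‖(A *ᵥ u) j‖ ^ 2) / 2 := fun j => by
    have := (Complex.re_le_norm _).trans_eq (norm_mul (u j) ((A *ᵥ u) j))
    nlinarith [sq_nonneg (‖u j‖ - ‖(A *ᵥ u) j‖)]
  have h2 : (u ⬝ᵥ (A *ᵥ u)).re ≤ ∑ j, (‖u j‖ ^ 2 + ‖(A *ᵥ u) j‖ ^ 2) / 2 := by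
    rw [dotProduct, Complex.re_sum]
    exact Finset.sum_le_sum fun j _ => h1 j
  rw [← Finset.sum_div, Finset.sum_add_distrib] at h2
  linarith [hA u hu]

/-- The complex matrix taking `(Re u, Im u)` to `(u, ū)`. -/
noncomputable def complexCoordinates (n : ℕ) : Matrix (Fin n ⊕ Fin n) (Fin n ⊕ Fin n) ℂ :=
  Matrix.fromBlocks 1 (Complex.I • 1) 1 (-(Complex.I • 1))

theorem complexCoordinates_mulVec (p : Fin n ⊕ Fin n → ℂ) :
    complexCoordinates n *ᵥ p = Sum.elim (fun j => p (Sum.inl j) + p (Sum.inr j) * Complex.I)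
      (fun j => p (Sum.inl j) - p (Sum.inr j) * Complex.I) := by
  rw [complexCoordinates, Matrix.fromBlocks_mulVec]
  congr 1 <;> ext j <;> simp [Matrix.neg_mulVec, Matrix.smul_mulVec] <;> ring

/-- The matrix, in real coordinates, of `(lam / 4) (2 u·ū - u·Au - ū·Bū)`. -/
noncomputable def gaussianMatrix (lam : ℝ) (A B : Matrix (Fin n) (Fin n) ℂ) :
    Matrix (Fin n ⊕ Fin n) (Fin n ⊕ Fin n) ℂ :=
  (lam / 4 : ℂ) • ((complexCoordinates n)ᵀ * Matrix.fromBlocks (-A) 1 1 (-B) *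
    complexCoordinates n)

/-- `u` and `v` are kept independent because `p` will be a real point minus a complex critical
point, where the second coordinate is no longer the conjugate of the first. -/
theorem gaussianMatrix_dotProduct (lam : ℝ) (A B : Matrix (Fin n) (Fin n) ℂ)
    (p : Fin n ⊕ Fin n → ℂ) {u v : Fin n → ℂ} (h : complexCoordinates n *ᵥ p = Sum.elim u v) :
    p ⬝ᵥ (gaussianMatrix lam A B *ᵥ p) =
      (lam / 4 : ℂ) * (2 * (u ⬝ᵥ v) - u ⬝ᵥ (A *ᵥ u) - v ⬝ᵥ (B *ᵥ v)) := by
  have h' : v ⬝ᵥ u = u ⬝ᵥ v := dotProduct_comm v u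
  rw [gaussianMatrix, Matrix.smul_mulVec, dotProduct_smul, ← Matrix.mulVec_mulVec,
    ← Matrix.mulVec_mulVec, Matrix.dotProduct_mulVec, Matrix.vecMul_transpose, h,
    Matrix.fromBlocks_mulVec, sumElim_dotProduct_sumElim, smul_eq_mul]
  simp only [Matrix.neg_mulVec, Sum.elim_comp_inl, Sum.elim_comp_inr, Matrix.one_mulVec,
    dotProduct_add, dotProduct_neg, h']
  ring

theorem gaussianMatrix_isSymm (lam : ℝ) {A B : Matrix (Fin n) (Fin n) ℂ} (hA : A.IsSymm)
    (hB : B.IsSymm) : (gaussianMatrix lam A B).IsSymm := by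
  rw [Matrix.IsSymm, gaussianMatrix, Matrix.transpose_smul, Matrix.transpose_mul,
    Matrix.transpose_mul, Matrix.transpose_transpose, Matrix.fromBlocks_transpose]
  simp [hA.eq, hB.eq, Matrix.mul_assoc]

theorem gaussianMatrix_zero (lam : ℝ) :
    gaussianMatrix lam (0 : Matrix (Fin n) (Fin n) ℂ) 0 = (lam / 2 : ℂ) • 1 := by
  rw [gaussianMatrix, complexCoordinates, Matrix.fromBlocks_transpose, Matrix.fromBlocks_multiply,
    Matrix.fromBlocks_multiply, ← Matrix.fromBlocks_one, Matrix.fromBlocks_smul,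
    Matrix.fromBlocks_smul]
  have h : (lam / 4 : ℂ) + lam / 4 = lam / 2 := by ring
  congr 1 <;> simp [smul_smul, ← add_smul, h]

/-- Comparing with the case `A = B = 0`, where the matrix is scalar, avoids computing the
determinant of the coordinate change. -/
theorem det_gaussianMatrix (lam : ℝ) (A B : Matrix (Fin n) (Fin n) ℂ) :
    (gaussianMatrix lam A B).det = (lam / 2 : ℂ) ^ (2 * n) * (1 - A * B).det := by
  have h1 : Matrix.fromBlocks (-A) 1 1 (-B) =
      Matrix.fromBlocks (-0) 1 1 (-0) * Matrix.fromBlocks 1 (-B) (-A) 1 := by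
    simp [Matrix.fromBlocks_multiply]
  have h2 : (gaussianMatrix lam A B).det =
      (gaussianMatrix lam (0 : Matrix (Fin n) (Fin n) ℂ) 0).det *
        (Matrix.fromBlocks 1 (-B) (-A) 1).det := by
    rw [gaussianMatrix, gaussianMatrix, h1]
    simp only [Matrix.det_smul, Matrix.det_mul]
    ring
  rw [h2, gaussianMatrix_zero, Matrix.det_smul, Matrix.det_fromBlocks_one₁₁]
  simp [two_mul]

theorem gaussianMatrix_re_posDef {lam : ℝ} (hlam : 0 < lam) {A B : Matrix (Fin n) (Fin n) ℂ}
    (hA : A.IsSymm) (hB : B.IsSymm) (hA' : IsStrictContraction A) (hB' : IsStrictContraction B) :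
    ((gaussianMatrix lam A B).map Complex.re).PosDef := by
  refine Matrix.PosDef.of_dotProduct_mulVec_pos ?_ fun x hx => ?_
  · ext i j
    simp [(gaussianMatrix_isSymm lam hA hB).apply i j]
  set u : Fin n → ℂ := fun j => (x (Sum.inl j) : ℂ) + x (Sum.inr j) * Complex.I with hu
  have hW : complexCoordinates n *ᵥ (fun i => (x i : ℂ)) = Sum.elim u (star u) := by
    rw [complexCoordinates_mulVec]
    congr 1
    ext j
    simp [hu, sub_eq_add_neg]
  have h1 : star x ⬝ᵥ ((gaussianMatrix lam A B).map Complex.re *ᵥ x) =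
      ((fun i => (x i : ℂ)) ⬝ᵥ (gaussianMatrix lam A B *ᵥ (fun i => (x i : ℂ)))).re := by
    simp [dotProduct, Matrix.mulVec]
  have hu0 : u ≠ 0 := by
    refine fun h0 => hx ?_
    ext i
    rcases i with j | j
    · simpa [hu] using congrArg Complex.re (congrFun h0 j)
    · simpa [hu] using congrArg Complex.im (congrFun h0 j)
  have h2 : u ⬝ᵥ star u = ((∑ j, ‖u j‖ ^ 2 : ℝ) : ℂ) := by
    simp [dotProduct, Complex.mul_conj, Complex.normSq_eq_norm_sq]
  have h3 := hA'.re_dotProduct_lt hu0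
  have h4 := hB'.re_dotProduct_lt (star_ne_zero.2 hu0)
  simp only [Pi.star_apply, norm_star] at h4
  rw [h1, gaussianMatrix_dotProduct lam A B _ hW, h2]
  have h5 : (lam / 4 : ℂ) = ((lam / 4 : ℝ) : ℂ) := by push_cast; rfl
  rw [h5, Complex.re_ofReal_mul, Complex.sub_re, Complex.sub_re]
  refine mul_pos (by positivity) ?_
  have h6 : (2 * ((∑ j, ‖u j‖ ^ 2 : ℝ) : ℂ)).re = 2 * ∑ j, ‖u j‖ ^ 2 := by
    rw [← Complex.ofReal_ofNat, Complex.re_ofReal_mul, Complex.ofReal_re]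
  rw [h6]
  linarith

/-- Gaussian integrals against the Fock measure; `s` and `t` are the coordinates of the critical
point of the exponent. -/
theorem exists_integral_fockMeasure_gaussian {lam : ℝ} (hlam : 0 < lam)
    {A B : Matrix (Fin n) (Fin n) ℂ} (hA : A.IsSymm) (hB : B.IsSymm)
    (hA' : IsStrictContraction A) (hB' : IsStrictContraction B) :
    ∃ c : ℂ, c ^ 2 * (1 - A * B).det = 1 ∧ ∀ s t : Fin n → ℂ,
      ∫ u, Complex.exp ((lam / 4 : ℂ) * (u ⬝ᵥ (A *ᵥ u) + star u ⬝ᵥ (B *ᵥ star u)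
        + 2 * ((t - A *ᵥ s) ⬝ᵥ u) + 2 * ((s - B *ᵥ t) ⬝ᵥ star u))) ∂(fockMeasure n lam) =
      c * Complex.exp ((lam / 4 : ℂ) * ((t - A *ᵥ s) ⬝ᵥ s + (s - B *ᵥ t) ⬝ᵥ t)) := by
  obtain ⟨c, hc, hint⟩ := exists_integral_cexp_neg_quadratic (gaussianMatrix_isSymm lam hA hB)
    (gaussianMatrix_re_posDef hlam hA hB hA' hB')
  have hpi : (Real.pi : ℂ) ≠ 0 := by exact_mod_cast Real.pi_ne_zero
  have hl : (lam : ℂ) ≠ 0 := by exact_mod_cast hlam.ne'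
  refine ⟨(lam / (2 * Real.pi)) ^ n * c, ?_, fun s t => ?_⟩
  · rw [det_gaussianMatrix] at hc
    simp only [Fintype.card_sum, Fintype.card_fin, ← two_mul] at hc
    have : ((lam / (2 * Real.pi)) ^ n * c : ℂ) ^ 2 * (1 - A * B).det =
        (c ^ 2 * ((lam / 2 : ℂ) ^ (2 * n) * (1 - A * B).det)) / (Real.pi : ℂ) ^ (2 * n) := by
      rw [pow_mul', pow_mul', div_pow, mul_pow, mul_pow, div_pow, div_pow]
      field_simp
    rw [this, hc, div_self (pow_ne_zero _ hpi)]
  -- The critical point in the complexified coordinates `(Re u, Im u)`: the values of `u` and `ū`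
  -- there are `s` and `t`, which need not be conjugate.
  · set v : Fin n ⊕ Fin n → ℂ := Sum.elim (fun j => (s j + t j) / 2)
      (fun j => (s j - t j) / (2 * Complex.I)) with hv
    have hWv : complexCoordinates n *ᵥ v = Sum.elim s t := by
      rw [complexCoordinates_mulVec]
      congr 1 <;> ext j <;> simp only [hv, Sum.elim_inl, Sum.elim_inr] <;>
        field_simp [Complex.I_ne_zero] <;> ring
    have hcont : Continuous fun u : Fin n → ℂ => Complex.exp (-(lam / 2) * (u ⬝ᵥ star u)) *
        Complex.exp ((lam / 4 : ℂ) * (u ⬝ᵥ (A *ᵥ u) + star u ⬝ᵥ (B *ᵥ star u)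
        + 2 * ((t - A *ᵥ s) ⬝ᵥ u) + 2 * ((s - B *ᵥ t) ⬝ᵥ star u))) := by
      fun_prop
    rw [integral_fockMeasure hlam, integral_pi_complex_eq _ hcont, mul_assoc, ← hint v, mul_comm
      (∫ x : Fin n ⊕ Fin n → ℝ, _)]
    congr 1
    rw [← integral_const_mul]
    refine integral_congr_ae (Filter.Eventually.of_forall fun x => ?_)
    simp only
    set u : Fin n → ℂ := fun j => (x (Sum.inl j) : ℂ) + x (Sum.inr j) * Complex.I with hu
    have hW : complexCoordinates n *ᵥ ((fun i => (x i : ℂ)) - v) =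
        Sum.elim (u - s) (star u - t) := by
      rw [Matrix.mulVec_sub, hWv, complexCoordinates_mulVec]
      ext i
      rcases i with j | j <;> simp [hu, sub_eq_add_neg]
    have hAs : u ⬝ᵥ (A *ᵥ s) = s ⬝ᵥ (A *ᵥ u) := by
      rw [Matrix.dotProduct_mulVec, ← Matrix.mulVec_transpose, hA.eq, dotProduct_comm]
    have hBt : star u ⬝ᵥ (B *ᵥ t) = t ⬝ᵥ (B *ᵥ star u) := by
      rw [Matrix.dotProduct_mulVec, ← Matrix.mulVec_transpose, hB.eq, dotProduct_comm]
    rw [gaussianMatrix_dotProduct lam A B _ hW, ← Complex.exp_add, ← Complex.exp_add]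
    congr 1
    simp only [Matrix.mulVec_sub, sub_dotProduct, dotProduct_sub]
    rw [dotProduct_comm (A *ᵥ s) u, dotProduct_comm (A *ᵥ s) s, dotProduct_comm (B *ᵥ t) (star u),
      dotProduct_comm (B *ᵥ t) t, hAs, hBt, dotProduct_comm t u, dotProduct_comm t s]
    ring

end FockGaussian

/-! ### Strict contractions from indefinite unitarity relations. -/

section Contraction

variable {n : ℕ}

theorem map_conj_eq (M : Matrix (Fin n) (Fin n) ℂ) : M.map conj = Mᴴᵀ := by
  ext i j; simp

theorem Matrix.IsSymm.map_conj_eq_conjTranspose {A : Matrix (Fin n) (Fin n) ℂ}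
    (hA : A.IsSymm) : A.map conj = Aᴴ := by
  conv_lhs => rw [← hA.eq]
  rfl

theorem sum_norm_sq_mulVec (M : Matrix (Fin n) (Fin n) ℂ) (v : Fin n → ℂ) :
    ((∑ j, ‖(M *ᵥ v) j‖ ^ 2 : ℝ) : ℂ) = star v ⬝ᵥ ((Mᴴ * M) *ᵥ v) := by
  rw [← Matrix.mulVec_mulVec, Matrix.dotProduct_mulVec, ← Matrix.star_mulVec]
  simp [dotProduct, Complex.conj_mul', Complex.ofReal_sum]

/-- With `u = Mv`, the hypothesis reads `|Mv|² = |Nv|² + |v|²`. -/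
theorem isStrictContraction_mul_inv {M N : Matrix (Fin n) (Fin n) ℂ} (hM : IsUnit M.det)
    (h : Mᴴ * M - Nᴴ * N = 1) : IsStrictContraction (N * M⁻¹) := by
  intro u hu
  have hv : u = M *ᵥ (M⁻¹ *ᵥ u) := by
    rw [Matrix.mulVec_mulVec, Matrix.mul_nonsing_inv _ hM, Matrix.one_mulVec]
  set v := M⁻¹ *ᵥ u with hvdef
  have hv0 : v ≠ 0 := by
    intro h0
    rw [h0, Matrix.mulVec_zero] at hv
    exact hu hv
  have h1 : ∑ j, ‖(M *ᵥ v) j‖ ^ 2 = ∑ j, ‖(N *ᵥ v) j‖ ^ 2 + ∑ j, ‖v j‖ ^ 2 := by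
    have h2 : ((∑ j, ‖v j‖ ^ 2 : ℝ) : ℂ) = star v ⬝ᵥ v := by
      simp [dotProduct, Complex.conj_mul', Complex.ofReal_sum]
    apply Complex.ofReal_injective
    rw [Complex.ofReal_add, sum_norm_sq_mulVec, sum_norm_sq_mulVec, h2, sub_eq_iff_eq_add.1 h,
      Matrix.add_mulVec, Matrix.one_mulVec, dotProduct_add, add_comm]
  have h3 : 0 < ∑ j, ‖v j‖ ^ 2 := by
    obtain ⟨j, hj⟩ := Function.ne_iff.1 hv0
    exact Finset.sum_pos' (fun _ _ => by positivity)
      ⟨j, Finset.mem_univ _, pow_pos (norm_pos_iff.2 hj) 2⟩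
  rw [← Matrix.mulVec_mulVec, ← hvdef, hv, h1]
  linarith

theorem IsStrictContraction.neg {A : Matrix (Fin n) (Fin n) ℂ} (hA : IsStrictContraction A) :
    IsStrictContraction (-A) := fun u hu => by
  simpa [Matrix.neg_mulVec] using hA u hu

theorem IsStrictContraction.map_conj {A : Matrix (Fin n) (Fin n) ℂ}
    (hA : IsStrictContraction A) : IsStrictContraction (A.map conj) := fun u hu => by
  have h := hA (star u) (star_ne_zero.2 hu)
  have h1 : (A.map conj) *ᵥ u = star (A *ᵥ star u) := by
    ext j
    simp [Matrix.mulVec, dotProduct]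
  rw [h1]
  simpa using h

end Contraction

/-! ### Block identities in `S`, generating functions, and composition of kernels. -/

namespace groupS

variable {n : ℕ} (k k' : groupS n)

theorem isUnit_det_P : IsUnit (blockP k).det := isUnit_iff_ne_zero.2 (det_P_ne_zero k)

theorem blockP_inv : blockP k⁻¹ = (blockP k)ᴴ := by
  have h : (k⁻¹).1.1 = -(Matrix.J (Fin n) ℂ * k.1.1ᵀ * Matrix.J (Fin n) ℂ) := by
    simpa using SymplecticGroup.coe_inv k.1
  rw [blockP, h, eq_fromBlocks, Matrix.J, Matrix.fromBlocks_transpose]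
  simp [Matrix.fromBlocks_multiply, Matrix.fromBlocks_neg, map_conj_eq]

theorem blockQ_inv : blockQ k⁻¹ = -(blockQ k)ᵀ := by
  have h : (k⁻¹).1.1 = -(Matrix.J (Fin n) ℂ * k.1.1ᵀ * Matrix.J (Fin n) ℂ) := by
    simpa using SymplecticGroup.coe_inv k.1
  rw [blockQ, h, eq_fromBlocks, Matrix.J, Matrix.fromBlocks_transpose]
  simp [Matrix.fromBlocks_multiply, Matrix.fromBlocks_neg]

theorem blockP_mul :
    blockP (k * k') = blockP k * blockP k' + blockQ k * (blockQ k').map conj := by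
  have h : (k * k').1.1 = k.1.1 * k'.1.1 := rfl
  rw [blockP, h, eq_fromBlocks k, eq_fromBlocks k', Matrix.fromBlocks_multiply,
    Matrix.toBlocks_fromBlocks₁₁]

theorem blockQ_mul :
    blockQ (k * k') = blockP k * blockQ k' + blockQ k * (blockP k').map conj := by
  have h : (k * k').1.1 = k.1.1 * k'.1.1 := rfl
  rw [blockQ, h, eq_fromBlocks k, eq_fromBlocks k', Matrix.fromBlocks_multiply,
    Matrix.toBlocks_fromBlocks₁₂]

/-- The column relations of `k` are the row relations of `k⁻¹`. -/
theorem conjTranspose_P_mul_sub :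
    (blockP k)ᴴ * blockP k - (blockQ k)ᵀ * (blockQ k).map conj = 1 := by
  have h := P_mul_sub k⁻¹
  rwa [blockP_inv, blockQ_inv, Matrix.conjTranspose_neg, neg_mul_neg,
    Matrix.conjTranspose_conjTranspose] at h

theorem conjTranspose_P_mul_Q :
    (blockP k)ᴴ * blockQ k = (blockQ k)ᵀ * (blockP k).map conj := by
  have h := P_mul_transpose k⁻¹
  rw [blockP_inv, blockQ_inv] at h
  simpa [map_conj_eq] using h

/-- The matrix `Q̄ P⁻¹` of the quadratic form in `z` of the kernel. -/
noncomputable def holoPart : Matrix (Fin n) (Fin n) ℂ := (blockQ k).map conj * (blockP k)⁻¹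

/-- The matrix `-P⁻¹ Q` of the quadratic form in `w̄` of the kernel. -/
noncomputable def antiholoPart : Matrix (Fin n) (Fin n) ℂ := -((blockP k)⁻¹ * blockQ k)

theorem transpose_P_mul_map_conj_Q :
    (blockP k)ᵀ * (blockQ k).map conj = (blockQ k)ᴴ * blockP k := by
  have h := congrArg (fun M => M.map conj) (conjTranspose_P_mul_Q k)
  simp only [Matrix.map_mul] at h
  have h1 : (blockP k)ᴴ.map conj = (blockP k)ᵀ := by ext; simp
  have h2 : ((blockP k).map conj).map conj = blockP k := by ext; simp
  rw [h1, h2] at h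
  exact h

theorem holoPart_isSymm : (holoPart k).IsSymm := by
  have hP := isUnit_det_P k
  have hPT : IsUnit (blockP k)ᵀ.det := by rwa [Matrix.det_transpose]
  have h : (holoPart k)ᵀ = (blockP k)ᵀ⁻¹ * (blockQ k)ᴴ := by
    rw [holoPart, Matrix.transpose_mul, Matrix.transpose_nonsing_inv, map_conj_eq,
      Matrix.transpose_transpose]
  rw [Matrix.IsSymm, h, holoPart]
  calc (blockP k)ᵀ⁻¹ * (blockQ k)ᴴ
      = (blockP k)ᵀ⁻¹ * ((blockQ k)ᴴ * blockP k) * (blockP k)⁻¹ := by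
        rw [Matrix.mul_assoc, Matrix.mul_assoc, Matrix.mul_nonsing_inv _ hP, Matrix.mul_one]
    _ = _ := by
        rw [← transpose_P_mul_map_conj_Q, ← Matrix.mul_assoc, Matrix.nonsing_inv_mul _ hPT,
          Matrix.one_mul]

theorem inv_P_mul_Q : (blockP k)⁻¹ * blockQ k = (blockQ k)ᵀ * (blockP k)ᵀ⁻¹ := by
  have hP := isUnit_det_P k
  have hPT : IsUnit (blockP k)ᵀ.det := by rwa [Matrix.det_transpose]
  calc (blockP k)⁻¹ * blockQ k
      = (blockP k)⁻¹ * (blockQ k * (blockP k)ᵀ) * (blockP k)ᵀ⁻¹ := by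
        rw [Matrix.mul_assoc, Matrix.mul_assoc, Matrix.mul_nonsing_inv _ hPT, Matrix.mul_one]
    _ = _ := by
        rw [← P_mul_transpose, ← Matrix.mul_assoc, Matrix.nonsing_inv_mul _ hP, Matrix.one_mul]

theorem antiholoPart_isSymm : (antiholoPart k).IsSymm := by
  rw [Matrix.IsSymm, antiholoPart, Matrix.transpose_neg, Matrix.transpose_mul,
    Matrix.transpose_nonsing_inv, inv_P_mul_Q]

theorem holoPart_isStrictContraction : IsStrictContraction (holoPart k) := by
  refine isStrictContraction_mul_inv (isUnit_det_P k) ?_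
  rw [← conjTranspose_P_mul_sub k]
  congr 2
  rw [map_conj_eq]
  ext i j
  simp

/-- Symmetry moves the inverse to the right, `P⁻¹Q = Qᵀ(Pᵀ)⁻¹`; the relation needed is then the
transpose of `PP* - QQ* = 1`. -/
theorem antiholoPart_isStrictContraction : IsStrictContraction (antiholoPart k) := by
  rw [antiholoPart, inv_P_mul_Q]
  refine (isStrictContraction_mul_inv ?_ ?_).neg
  · rw [Matrix.det_transpose]
    exact isUnit_det_P k
  · have h := congrArg Matrix.transpose (P_mul_sub k)
    rw [Matrix.transpose_sub, Matrix.transpose_mul, Matrix.transpose_mul,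
      Matrix.transpose_one] at h
    rw [← h]
    rfl

/-- This is the Schur complement of `P` in `k`. Multiplied by `Pᵀ` on the left, it becomes `PᵀP̄ -
Q*Q = 1` thanks to `PᵀQ̄ = Q*P`. -/
theorem map_conj_P_sub : (blockP k).map conj - holoPart k * blockQ k = (blockP k)⁻¹ᵀ := by
  have hP := isUnit_det_P k
  have hPT : IsUnit (blockP k)ᵀ.det := by rwa [Matrix.det_transpose]
  rw [Matrix.transpose_nonsing_inv]
  refine (Matrix.inv_eq_right_inv ?_).symm
  have h := congrArg Matrix.transpose (conjTranspose_P_mul_sub k)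
  rw [Matrix.transpose_sub, Matrix.transpose_mul, Matrix.transpose_mul, Matrix.transpose_one,
    map_conj_eq (blockQ k), Matrix.transpose_transpose, Matrix.transpose_transpose] at h
  rw [Matrix.mul_sub, holoPart, ← Matrix.mul_assoc, ← Matrix.mul_assoc,
    transpose_P_mul_map_conj_Q, Matrix.mul_assoc (blockQ k)ᴴ, Matrix.mul_nonsing_inv _ hP,
    Matrix.mul_one, map_conj_eq]
  exact h

/-- The quadratic form in the exponent of the kernel. -/
noncomputable def phase (z ω : Fin n → ℂ) : ℂ :=
  z ⬝ᵥ (holoPart k *ᵥ z) + 2 * (((blockP k)⁻¹ *ᵥ z) ⬝ᵥ ω) + ω ⬝ᵥ (antiholoPart k *ᵥ ω)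

theorem metaplecticKernel_eq (lam : ℝ) (z w : Fin n → ℂ) :
    metaplecticKernel lam k z w =
      (blockP k).det ^ (-(1 / 2) : ℂ) * Complex.exp ((lam / 4 : ℂ) * phase k z (star w)) := by
  rw [metaplecticKernel, phase, holoPart, antiholoPart, Matrix.neg_mulVec, dotProduct_neg,
    ← sub_eq_add_neg]

/-- Apart from its value 1 at `k = 1`, this is the only property of the branch of the square root
that enters. -/
theorem det_cpow_sq_mul_det : ((blockP k).det ^ (-(1 / 2) : ℂ)) ^ 2 * (blockP k).det = 1 := by
  rw [← Complex.cpow_nat_mul]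
  norm_num
  rw [Complex.cpow_neg_one, inv_mul_cancel₀ (det_P_ne_zero k)]

/-- Half the `z`-gradient of `phase` is `holoPart k *ᵥ z + (P⁻¹)ᵀ ω`; this identifies it with the
second component of `k (r, ω)`. -/
theorem holoPart_mulVec_first (r ω : Fin n → ℂ) :
    holoPart k *ᵥ (blockP k *ᵥ r + blockQ k *ᵥ ω) =
      (blockQ k).map conj *ᵥ r + (blockP k).map conj *ᵥ ω - (blockP k)⁻¹ᵀ *ᵥ ω := by
  rw [← map_conj_P_sub, Matrix.sub_mulVec, Matrix.mulVec_add, Matrix.mulVec_mulVec,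
    Matrix.mulVec_mulVec, holoPart, Matrix.mul_assoc _ _ (blockP k),
    Matrix.nonsing_inv_mul _ (isUnit_det_P k), Matrix.mul_one]
  abel

/-- The companion statement: half the `ω`-gradient of `phase` is `r`. -/
theorem antiholoPart_mulVec (r ω : Fin n → ℂ) :
    antiholoPart k *ᵥ ω = r - (blockP k)⁻¹ *ᵥ (blockP k *ᵥ r + blockQ k *ᵥ ω) := by
  rw [antiholoPart, Matrix.mulVec_add, Matrix.mulVec_mulVec, Matrix.mulVec_mulVec,
    Matrix.nonsing_inv_mul _ (isUnit_det_P k), Matrix.one_mulVec, Matrix.neg_mulVec]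
  abel

theorem dotProduct_inv_P_transpose (z ω : Fin n → ℂ) :
    z ⬝ᵥ ((blockP k)⁻¹ᵀ *ᵥ ω) = ((blockP k)⁻¹ *ᵥ z) ⬝ᵥ ω := by
  rw [Matrix.dotProduct_mulVec, Matrix.vecMul_transpose]

/-- The exponent of the kernel is the generating function of the linear map `k`. -/
theorem phase_eq {z y r ω : Fin n → ℂ} (hz : z = blockP k *ᵥ r + blockQ k *ᵥ ω)
    (hy : y = (blockQ k).map conj *ᵥ r + (blockP k).map conj *ᵥ ω) :
    phase k z ω = z ⬝ᵥ y + ω ⬝ᵥ r := by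
  have h1 : holoPart k *ᵥ z = y - (blockP k)⁻¹ᵀ *ᵥ ω := by
    rw [hz, hy, holoPart_mulVec_first]
  have h2 : antiholoPart k *ᵥ ω = r - (blockP k)⁻¹ *ᵥ z := by
    rw [hz, ← antiholoPart_mulVec]
  rw [phase, h1, h2, dotProduct_sub, dotProduct_sub, dotProduct_inv_P_transpose,
    dotProduct_comm ω (_ *ᵥ _)]
  ring

/-- The `P`-block of the product factors as `PP' + QQ̄' = P (1 + P⁻¹Q · Q̄'P'⁻¹) P'`. -/
theorem det_one_sub_holoPart_mul :
    (blockP k).det * (blockP k').det * (1 - holoPart k' * antiholoPart k).det =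
      (blockP (k * k')).det := by
  have h1 : (1 - holoPart k' * antiholoPart k).det =
      (1 + (blockP k)⁻¹ * blockQ k * holoPart k').det := by
    rw [antiholoPart, Matrix.mul_neg, sub_neg_eq_add, Matrix.det_one_add_mul_comm]
  have h2 : blockP (k * k') =
      blockP k * (1 + (blockP k)⁻¹ * blockQ k * holoPart k') * blockP k' := by
    rw [Matrix.mul_add, Matrix.add_mul, blockP_mul, Matrix.mul_one, holoPart]
    congr 1
    simp only [Matrix.mul_assoc]
    rw [Matrix.nonsing_inv_mul _ (isUnit_det_P k'), Matrix.mul_one, ← Matrix.mul_assoc,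
      Matrix.mul_nonsing_inv _ (isUnit_det_P k), Matrix.one_mul]
  rw [h1, h2, Matrix.det_mul, Matrix.det_mul]
  ring

/-- The composition of two kernels. -/
theorem exists_integral_metaplecticKernel_mul {lam : ℝ} (hlam : 0 < lam) :
    ∃ ε : ℂ, ε ^ 2 = 1 ∧ ∀ z w : Fin n → ℂ,
      ∫ u, metaplecticKernel lam k z u * metaplecticKernel lam k' u w ∂(fockMeasure n lam) =
        ε * metaplecticKernel lam (k * k') z w := by
  obtain ⟨c, hc, hint⟩ := exists_integral_fockMeasure_gaussian hlam (holoPart_isSymm k')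
    (antiholoPart_isSymm k) (holoPart_isStrictContraction k') (antiholoPart_isStrictContraction k)
  have e1 := det_cpow_sq_mul_det k
  have e2 := det_cpow_sq_mul_det k'
  have e3 := det_cpow_sq_mul_det (k * k')
  have hker := fun z u => metaplecticKernel_eq k lam z u
  have hker' := fun z u => metaplecticKernel_eq k' lam z u
  have hker'' := fun z u => metaplecticKernel_eq (k * k') lam z u
  set d := (blockP k).det ^ (-(1 / 2) : ℂ)
  set d' := (blockP k').det ^ (-(1 / 2) : ℂ)
  set d'' := (blockP (k * k')).det ^ (-(1 / 2) : ℂ)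
  have hd'' : d'' ≠ 0 := fun h => by simp [h] at e3
  refine ⟨d * d' * c / d'', ?_, fun z w => ?_⟩
  · have h0 : d'' ^ 2 = (d * d' * c) ^ 2 := by
      have hne := det_P_ne_zero (k * k')
      apply mul_right_cancel₀ hne
      rw [e3, ← det_one_sub_holoPart_mul]
      linear_combination (-d' ^ 2 * (blockP k').det * c ^ 2 *
        (1 - holoPart k' * antiholoPart k).det) * e1 - c ^ 2 *
        (1 - holoPart k' * antiholoPart k).det * e2 - hc
    rw [div_pow, ← h0, div_self (pow_ne_zero _ hd'')]
  · set ω := star w with hω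
    -- `r` is chosen so that `kk'` sends `(r, ω)` to a pair with first component `z`. The
    -- intermediate pair `(s, t) = k' (r, ω)` is the critical point: there the gradients of the two
    -- phases match the pairing `u·ū` of the weight.
    set r := (blockP (k * k'))⁻¹ *ᵥ (z - blockQ (k * k') *ᵥ ω) with hr
    set s := blockP k' *ᵥ r + blockQ k' *ᵥ ω with hs
    set t := (blockQ k').map conj *ᵥ r + (blockP k').map conj *ᵥ ω with ht
    have hz'' : z = blockP (k * k') *ᵥ r + blockQ (k * k') *ᵥ ω := by
      rw [hr, Matrix.mulVec_mulVec, Matrix.mul_nonsing_inv _ (isUnit_det_P _), Matrix.one_mulVec]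
      abel
    have hz : z = blockP k *ᵥ s + blockQ k *ᵥ t := by
      rw [hz'', hs, ht, blockP_mul, blockQ_mul]
      simp only [Matrix.mulVec_add, Matrix.add_mulVec, ← Matrix.mulVec_mulVec]
      abel
    set y := (blockQ k).map conj *ᵥ s + (blockP k).map conj *ᵥ t with hy
    have hy'' : y = (blockQ (k * k')).map conj *ᵥ r + (blockP (k * k')).map conj *ᵥ ω := by
      have hcc : ∀ M : Matrix (Fin n) (Fin n) ℂ, (M.map conj).map conj = M := fun M => by
        ext; simp
      rw [hy, hs, ht, blockP_mul, blockQ_mul, Matrix.map_add _ (map_add _),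
        Matrix.map_add _ (map_add _), Matrix.map_mul, Matrix.map_mul, Matrix.map_mul,
        Matrix.map_mul, hcc, hcc]
      simp only [Matrix.mulVec_add, Matrix.add_mulVec, ← Matrix.mulVec_mulVec]
      abel
    have hts : t - holoPart k' *ᵥ s = (blockP k')⁻¹ᵀ *ᵥ ω := by
      rw [hs, ht, holoPart_mulVec_first]
      abel
    have hst : s - antiholoPart k *ᵥ t = (blockP k)⁻¹ *ᵥ z := by
      rw [antiholoPart_mulVec k s t, ← hz]
      abel
    have p1 := phase_eq k hz hy
    have p2 := phase_eq k' hs ht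
    have p3 := phase_eq (k * k') hz'' hy''
    have q1 : t ⬝ᵥ (antiholoPart k *ᵥ t) = s ⬝ᵥ t - ((blockP k)⁻¹ *ᵥ z) ⬝ᵥ t := by
      rw [antiholoPart_mulVec k s t, ← hz, dotProduct_sub, dotProduct_comm t, dotProduct_comm t]
    have q2 : s ⬝ᵥ (holoPart k' *ᵥ s) = s ⬝ᵥ t - ((blockP k')⁻¹ᵀ *ᵥ ω) ⬝ᵥ s := by
      rw [← sub_eq_iff_eq_add'.2 (sub_eq_iff_eq_add.1 hts), dotProduct_sub,
        dotProduct_comm _ s]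
    have q3 : ((blockP k')⁻¹ *ᵥ s) ⬝ᵥ ω = ((blockP k')⁻¹ᵀ *ᵥ ω) ⬝ᵥ s := by
      rw [dotProduct_comm _ s, dotProduct_inv_P_transpose]
    -- The composition law is `phase (k * k') z ω = phase k z t + phase k' s ω - 2 s·t`; `q1` and
    -- `q2` eliminate the terms quadratic in `s` and `t`.
    have key : phase (k * k') z ω = z ⬝ᵥ (holoPart k *ᵥ z) + ω ⬝ᵥ (antiholoPart k' *ᵥ ω) +
        (((blockP k')⁻¹ᵀ *ᵥ ω) ⬝ᵥ s + ((blockP k)⁻¹ *ᵥ z) ⬝ᵥ t) := by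
      rw [p3]
      rw [phase, q1, dotProduct_comm t s] at p1
      rw [phase, q2, q3] at p2
      linear_combination -p1 - p2
    have hi := hint s t
    rw [hts, hst] at hi
    have hstep : ∀ u, metaplecticKernel lam k z u * metaplecticKernel lam k' u w =
        (d * d' * Complex.exp ((lam / 4 : ℂ) * (z ⬝ᵥ (holoPart k *ᵥ z) +
          ω ⬝ᵥ (antiholoPart k' *ᵥ ω)))) *
        Complex.exp ((lam / 4 : ℂ) * (u ⬝ᵥ (holoPart k' *ᵥ u) +
          star u ⬝ᵥ (antiholoPart k *ᵥ star u) + 2 * (((blockP k')⁻¹ᵀ *ᵥ ω) ⬝ᵥ u) +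
          2 * (((blockP k)⁻¹ *ᵥ z) ⬝ᵥ star u))) := fun u => by
      rw [hker, hker', mul_mul_mul_comm, mul_assoc (d * d'), ← Complex.exp_add,
        ← Complex.exp_add]
      congr 2
      rw [phase, phase, dotProduct_comm (_ *ᵥ ω) u, dotProduct_inv_P_transpose, ← hω]
      ring
    simp_rw [hstep]
    rw [integral_const_mul, hi, hker'', ← hω, key, mul_add (lam / 4 : ℂ) (_ + _) (_ + _),
      Complex.exp_add]
    field_simp

/-- The adjoint kernel is, up to sign, the kernel of the inverse. -/
theorem exists_conj_metaplecticKernel (lam : ℝ) :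
    ∃ ε : ℂ, ε ^ 2 = 1 ∧ ∀ z w : Fin n → ℂ,
      conj (metaplecticKernel lam k w z) = ε * metaplecticKernel lam k⁻¹ z w := by
  have e1 := det_cpow_sq_mul_det k
  have e2 := det_cpow_sq_mul_det k⁻¹
  have hker := fun z u => metaplecticKernel_eq k lam z u
  have hker' := fun z u => metaplecticKernel_eq k⁻¹ lam z u
  have hdet : (blockP k⁻¹).det = conj (blockP k).det := by
    rw [blockP_inv, Matrix.det_conjTranspose]; rfl
  set d := (blockP k).det ^ (-(1 / 2) : ℂ)
  set d' := (blockP k⁻¹).det ^ (-(1 / 2) : ℂ)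
  have hd' : d' ≠ 0 := fun h => by simp [h] at e2
  refine ⟨conj d / d', ?_, fun z w => ?_⟩
  · have h0 : d' ^ 2 = (conj d) ^ 2 := by
      apply mul_right_cancel₀ (det_P_ne_zero k⁻¹)
      rw [e2, hdet, ← map_pow, ← map_mul, e1, map_one]
    rw [div_pow, ← h0, div_self (pow_ne_zero _ hd')]
  · have hA : holoPart k⁻¹ = (antiholoPart k).map conj := by
      rw [(antiholoPart_isSymm k).map_conj_eq_conjTranspose, holoPart, antiholoPart, blockP_inv,
        blockQ_inv, Matrix.conjTranspose_neg, Matrix.conjTranspose_mul,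
        Matrix.conjTranspose_nonsing_inv, ← neg_mul]
      congr 1
    have hB : antiholoPart k⁻¹ = (holoPart k).map conj := by
      rw [(holoPart_isSymm k).map_conj_eq_conjTranspose, holoPart, antiholoPart, blockP_inv,
        blockQ_inv, Matrix.conjTranspose_mul, Matrix.conjTranspose_nonsing_inv, Matrix.mul_neg,
        neg_neg]
      congr 1
      ext
      simp
    have hP : (blockP k⁻¹)⁻¹ = (blockP k)⁻¹ᴴ := by
      rw [blockP_inv, Matrix.conjTranspose_nonsing_inv]
    have hmv : ∀ (M : Matrix (Fin n) (Fin n) ℂ) (v : Fin n → ℂ),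
        conj (v ⬝ᵥ (M *ᵥ v)) = star v ⬝ᵥ (M.map conj *ᵥ star v) := fun M v => by
      simp [dotProduct, Matrix.mulVec]
    have hphase : conj (phase k w (star z)) = phase k⁻¹ z (star w) := by
      rw [phase, phase, hA, hB, hP]
      have h1 : conj (((blockP k)⁻¹ *ᵥ w) ⬝ᵥ star z) = ((blockP k)⁻¹ᴴ *ᵥ z) ⬝ᵥ star w := by
        rw [← dotProduct_inv_P_transpose k w (star z)]
        simp [dotProduct, Matrix.mulVec, mul_comm]
      simp only [map_add, map_mul, hmv, star_star, h1, Complex.conj_ofNat]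
      ring
    rw [hker, hker', map_mul, ← Complex.exp_conj, map_mul, hphase]
    have : conj (lam / 4 : ℂ) = lam / 4 := by rw [map_div₀, Complex.conj_ofReal, Complex.conj_ofNat]
    rw [this]
    field_simp

end groupS

/-! ### Integrability, the mean value property and the reproducing kernel. -/

section FockMeasure

variable {n : ℕ} {lam : ℝ}

theorem isStrictContraction_zero : IsStrictContraction (0 : Matrix (Fin n) (Fin n) ℂ) := by
  simpa using isStrictContraction_mul_inv (M := (1 : Matrix (Fin n) (Fin n) ℂ)) (N := 0)
    (by simp) (by simp)

/-- The Gaussian formula with all data zero shows that the total mass has square 1. -/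
theorem isProbabilityMeasure_fockMeasure (hlam : 0 < lam) :
    IsProbabilityMeasure (fockMeasure n lam) := by
  obtain ⟨c, hc, hint⟩ := exists_integral_fockMeasure_gaussian (n := n) hlam
    Matrix.isSymm_zero Matrix.isSymm_zero isStrictContraction_zero isStrictContraction_zero
  have h := hint 0 0
  simp only [Matrix.zero_mulVec, dotProduct_zero, sub_self, zero_dotProduct, mul_zero, add_zero,
    Complex.exp_zero, integral_const, mul_one, Complex.real_smul] at h
  rw [← h] at hc
  simp only [mul_zero, sub_zero, Matrix.det_one, mul_one] at hc
  have h1 : (fockMeasure n lam).real Set.univ ^ 2 = 1 := by exact_mod_cast hc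
  have h2 : (fockMeasure n lam).real Set.univ = 1 :=
    (pow_eq_one_iff_of_nonneg measureReal_nonneg two_ne_zero).1 h1
  exact ⟨(ENNReal.toReal_eq_one_iff _).1 h2⟩

theorem integrable_fockMeasure_iff (hlam : 0 < lam) (F : (Fin n → ℂ) → ℂ) :
    Integrable F (fockMeasure n lam) ↔
      Integrable fun u => Complex.exp (-(lam / 2) * (u ⬝ᵥ star u)) * F u := by
  rw [fockMeasure, integrable_withDensity_iff_integrable_smul' (by fun_prop) (by simp)]
  have h0 : ((2 * Real.pi)⁻¹ ^ n * lam ^ n : ℂ) ≠ 0 := by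
    have := Real.pi_ne_zero
    have := hlam.ne'
    simp [*]
  rw [← integrable_const_mul_iff h0.isUnit
    fun u => Complex.exp (-(lam / 2) * (u ⬝ᵥ star u)) * F u]
  refine integrable_congr (Filter.Eventually.of_forall fun u => ?_)
  have h : u ⬝ᵥ star u = ((∑ j, ‖u j‖ ^ 2 : ℝ) : ℂ) := by
    simp [dotProduct, Complex.mul_conj, Complex.normSq_eq_norm_sq]
  simp only [h]
  rw [ENNReal.toReal_ofReal (by positivity), Complex.real_smul]
  push_cast
  ring

/-- Gaussians in `w̄` given by a strict contraction are square integrable. -/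
theorem memLp_gaussian (hlam : 0 < lam) {B : Matrix (Fin n) (Fin n) ℂ} (hB : B.IsSymm)
    (hB' : IsStrictContraction B) (p : Fin n → ℂ) :
    MemLp (fun w => Complex.exp ((lam / 4 : ℂ) * (2 * (p ⬝ᵥ star w) +
      star w ⬝ᵥ (B *ᵥ star w)))) 2 (fockMeasure n lam) := by
  have hA : (B.map conj).IsSymm := by
    ext i j
    simp [hB.apply i j]
  obtain ⟨c, hc, hint⟩ := exists_integral_fockMeasure_gaussian hlam hA hB hB'.map_conj hB'
  have hdet : IsUnit (1 - B.map conj * B).det := isUnit_iff_ne_zero.2 fun h => by simp [h] at hc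
  have hc0 : c ≠ 0 := fun h => by simp [h] at hc
  -- The squared modulus is a Gaussian with matrices `B̄`, `B` and linear coefficients `star p`,
  -- `p`. Its critical point solves `s - Bt = p`, `t - B̄s = star p`.
  set t := (1 - B.map conj * B)⁻¹ *ᵥ (B.map conj *ᵥ p + star p) with ht
  set s := B *ᵥ t + p with hs
  have h1 : s - B *ᵥ t = p := by rw [hs]; abel
  have h2 : t - B.map conj *ᵥ s = star p := by
    have h3 : (1 - B.map conj * B) *ᵥ t = B.map conj *ᵥ p + star p := by
      rw [ht, Matrix.mulVec_mulVec, Matrix.mul_nonsing_inv _ hdet, Matrix.one_mulVec]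
    rw [Matrix.sub_mulVec, Matrix.one_mulVec, ← Matrix.mulVec_mulVec] at h3
    rw [hs, Matrix.mulVec_add, sub_add_eq_sub_sub, h3]
    abel
  have hi := hint s t
  rw [h1, h2] at hi
  -- The Bochner integral of a non-integrable function is 0, so the nonzero value just computed
  -- proves integrability.
  have hI := (Integrable.of_integral_ne_zero
    (hi ▸ mul_ne_zero hc0 (Complex.exp_ne_zero _))).norm
  have hcont : Continuous fun w : Fin n → ℂ => Complex.exp ((lam / 4 : ℂ) * (2 * (p ⬝ᵥ star w) +
      star w ⬝ᵥ (B *ᵥ star w))) := by fun_prop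
  rw [memLp_two_iff_integrable_sq_norm hcont.aestronglyMeasurable]
  refine hI.congr (Filter.Eventually.of_forall fun w => ?_)
  simp only
  rw [sq, ← norm_star (Complex.exp ((lam / 4 : ℂ) * (2 * (p ⬝ᵥ star w) + _)))]
  nth_rw 2 [norm_star]
  rw [← norm_mul, Complex.star_def, ← Complex.exp_conj, ← Complex.exp_add]
  congr 2
  have h4 : conj (p ⬝ᵥ star w) = star p ⬝ᵥ w := by simp [dotProduct]
  have h5 : conj (star w ⬝ᵥ (B *ᵥ star w)) = w ⬝ᵥ (B.map conj *ᵥ w) := by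
    simp [dotProduct, Matrix.mulVec]
  simp only [map_mul, map_add, h4, h5, map_div₀, Complex.conj_ofReal, Complex.conj_ofNat]
  ring

theorem measurePreserving_smul_fockMeasure (a : Circle) :
    MeasurePreserving (fun w : Fin n → ℂ => (a : ℂ) • w) (fockMeasure n lam)
      (fockMeasure n lam) := by
  have h : MeasurePreserving (fun w : Fin n → ℂ => (a : ℂ) • w) :=
    volume_preserving_pi fun _ : Fin n => (rotation a).measurePreserving
  refine ⟨h.measurable, ?_⟩
  ext s hs
  rw [Measure.map_apply h.measurable hs, fockMeasure, withDensity_apply _ hs,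
    withDensity_apply _ (h.measurable hs), ← h.setLIntegral_comp_preimage hs (by fun_prop)]
  simp only [Pi.smul_apply, norm_smul, Circle.norm_coe, one_mul]

/-- The mean value property for the Gaussian measure. -/
theorem integral_fockMeasure_eq_apply_zero (hlam : 0 < lam) {h : (Fin n → ℂ) → ℂ}
    (hd : Differentiable ℂ h) (hi : Integrable h (fockMeasure n lam)) :
    ∫ w, h w ∂(fockMeasure n lam) = h 0 := by
  have := isProbabilityMeasure_fockMeasure (n := n) hlam
  have hmp : ∀ θ : ℝ, MeasurePreserving (fun w : Fin n → ℂ => circleMap 0 1 θ • w)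
      (fockMeasure n lam) (fockMeasure n lam) := fun θ => by
    have h1 := measurePreserving_smul_fockMeasure (n := n) (lam := lam) (Circle.exp θ)
    simpa [circleMap] using h1
  -- The one-variable mean value property on the complex line through `w`. Rotation invariance of
  -- the measure and Fubini transfer it to the Gaussian average.
  have hmean : ∀ w, ∫ θ in (0 : ℝ)..2 * Real.pi, h (circleMap 0 1 θ • w) =
      (2 * Real.pi) • h 0 := fun w => by
    have hdw : Differentiable ℂ fun ζ : ℂ => h (ζ • w) := by fun_prop
    have h1 := DiffContOnCl.circleAverage (f := fun ζ : ℂ => h (ζ • w)) (c := 0) (R := 1)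
      hdw.diffContOnCl
    rw [Real.circleAverage, zero_smul] at h1
    rw [← h1, smul_smul, mul_inv_cancel₀ (by positivity), one_smul]
  have hcont : Continuous fun p : ℝ × (Fin n → ℂ) => h (circleMap 0 1 p.1 • p.2) := by
    have := hd.continuous
    have := continuous_circleMap 0 1
    fun_prop
  have hrot : ∀ θ : ℝ, ∫ w, h (circleMap 0 1 θ • w) ∂(fockMeasure n lam) =
      ∫ w, h w ∂(fockMeasure n lam) := fun θ => by
    have h2 := integral_map (μ := fockMeasure n lam) (hmp θ).measurable.aemeasurable
      (f := h) hd.continuous.aestronglyMeasurable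
    rw [← h2, (hmp θ).map_eq]
  have hrotn : ∀ θ : ℝ, ∫ w, ‖h (circleMap 0 1 θ • w)‖ ∂(fockMeasure n lam) =
      ∫ w, ‖h w‖ ∂(fockMeasure n lam) := fun θ => by
    have h2 := integral_map (μ := fockMeasure n lam) (hmp θ).measurable.aemeasurable
      (f := fun w => ‖h w‖) hd.continuous.norm.aestronglyMeasurable
    rw [← h2, (hmp θ).map_eq]
  have hprod : Integrable (Function.uncurry fun (θ : ℝ) (w : Fin n → ℂ) =>
      h (circleMap 0 1 θ • w))
      ((volume.restrict (Set.Ioc 0 (2 * Real.pi))).prod (fockMeasure n lam)) := by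
    refine (integrable_prod_iff hcont.aestronglyMeasurable).2 ⟨Filter.Eventually.of_forall fun θ => ?_, ?_⟩
    · exact (hmp θ).integrable_comp_of_integrable hi
    · simp only [hrotn]
      exact integrable_const _
  have hswap := integral_integral_swap hprod
  simp only [hrot, integral_const] at hswap
  rw [integral_congr_ae (Filter.Eventually.of_forall fun w =>
    (intervalIntegral.integral_of_le (by positivity)).symm.trans (hmean w))] at hswap
  simp only [integral_const, probReal_univ, one_smul, measureReal_restrict_apply_univ,
    Real.volume_real_Ioc_of_le Real.two_pi_pos.le, sub_zero] at hswap
  exact smul_right_injective ℂ Real.two_pi_pos.ne' hswap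

theorem memLp_reproducingKernel (hlam : 0 < lam) (z : Fin n → ℂ) :
    MemLp (fun w => Complex.exp ((lam / 2 : ℂ) * (z ⬝ᵥ star w))) 2 (fockMeasure n lam) := by
  refine (memLp_gaussian hlam Matrix.isSymm_zero isStrictContraction_zero z).congr_norm
    (by fun_prop) (Filter.Eventually.of_forall fun w => ?_)
  rw [Matrix.zero_mulVec, dotProduct_zero, add_zero]
  congr 2
  ring

/-- The reproducing property of the kernel `exp (lam z·w̄ / 2)`. -/
theorem integral_reproducing (hlam : 0 < lam) {f : (Fin n → ℂ) → ℂ} (hd : Differentiable ℂ f)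
    (hf : MemLp f 2 (fockMeasure n lam)) (z : Fin n → ℂ) :
    ∫ w, Complex.exp ((lam / 2 : ℂ) * (z ⬝ᵥ star w)) * f w ∂(fockMeasure n lam) = f z := by
  have hi : Integrable (fun w => Complex.exp ((lam / 2 : ℂ) * (z ⬝ᵥ star w)) * f w)
      (fockMeasure n lam) := 
    MemLp.integrable_mul (memLp_reproducingKernel hlam z) hf
  -- Translation by `z` turns weight times kernel times `f` into weight times a holomorphic `g` with
  -- `g 0 = f z`, so the mean value property applies.
  set g : (Fin n → ℂ) → ℂ := fun w => Complex.exp (-(lam / 2) * (w ⬝ᵥ star z)) * f (w + z)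
    with hg
  have hshift : ∀ w, Complex.exp (-(lam / 2) * ((w + z) ⬝ᵥ star (w + z))) *
      (Complex.exp ((lam / 2 : ℂ) * (z ⬝ᵥ star (w + z))) * f (w + z)) =
      Complex.exp (-(lam / 2) * (w ⬝ᵥ star w)) * g w := fun w => by
    rw [hg]
    simp only
    rw [← mul_assoc, ← mul_assoc, ← Complex.exp_add, ← Complex.exp_add]
    congr 2
    rw [star_add]
    simp only [add_dotProduct, dotProduct_add]
    ring
  have hgd : Differentiable ℂ g := by
    have : Differentiable ℂ fun w : Fin n → ℂ => w ⬝ᵥ star z := by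
      unfold dotProduct
      fun_prop
    fun_prop
  have hgi : Integrable g (fockMeasure n lam) := by
    rw [integrable_fockMeasure_iff hlam] at hi ⊢
    refine (hi.comp_add_right z).congr (Filter.Eventually.of_forall fun w => ?_)
    exact hshift w
  have h0 := integral_fockMeasure_eq_apply_zero hlam hgd hgi
  rw [integral_fockMeasure hlam] at h0 ⊢
  rw [← integral_add_right_eq_self _ z]
  simp_rw [hshift]
  rw [h0]
  simp [hg]

end FockMeasure

/-! ### Completeness of the Fock space. -/

section Completeness

variable {n : ℕ} {lam : ℝ}

/-- The dominating weight for differentiation under the integral. Its square uses up half of the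
Gaussian decay, leaving the Fock weight of parameter `lam / 2`. -/
theorem memLp_exp_sq (hlam : 0 < lam) :
    MemLp (fun w : Fin n → ℂ => Complex.exp ((lam / 8 : ℂ) * (w ⬝ᵥ star w))) 2
      (fockMeasure n lam) := by
  have hcont : Continuous fun w : Fin n → ℂ => Complex.exp ((lam / 8 : ℂ) * (w ⬝ᵥ star w)) := by
    fun_prop
  rw [memLp_two_iff_integrable_sq_norm hcont.aestronglyMeasurable]
  have := isProbabilityMeasure_fockMeasure (n := n) (half_pos hlam)
  have h1 := (integrable_fockMeasure_iff (n := n) (half_pos hlam) fun _ => 1).1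
    (integrable_const _)
  have h2 : Integrable (fun w : Fin n → ℂ => Complex.exp ((lam / 8 : ℂ) * (w ⬝ᵥ star w)) ^ 2)
      (fockMeasure n lam) := by
    rw [integrable_fockMeasure_iff hlam]
    refine h1.congr (Filter.Eventually.of_forall fun w => ?_)
    simp only
    rw [mul_one, ← Complex.exp_nat_mul, ← Complex.exp_add]
    congr 1
    push_cast
    ring
  simpa only [norm_pow] using h2.norm

/-- The continuous linear form `z ↦ z · w̄`. -/
noncomputable def pairing (w : Fin n → ℂ) : (Fin n → ℂ) →L[ℂ] ℂ :=
  ∑ j, conj (w j) • ContinuousLinearMap.proj j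

theorem pairing_apply (w z : Fin n → ℂ) : pairing w z = z ⬝ᵥ star w := by
  simp [pairing, dotProduct, mul_comm]

theorem norm_dotProduct_star_le (z w : Fin n → ℂ) : ‖z ⬝ᵥ star w‖ ≤ ‖z‖ * ∑ j, ‖w j‖ := by
  rw [dotProduct, Finset.mul_sum]
  refine (norm_sum_le _ _).trans (Finset.sum_le_sum fun j _ => ?_)
  rw [norm_mul, Pi.star_apply, norm_star]
  exact mul_le_mul_of_nonneg_right (norm_le_pi_norm z j) (norm_nonneg _)

theorem norm_pairing_le (w : Fin n → ℂ) : ‖pairing w‖ ≤ ∑ j, ‖w j‖ := by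
  refine ContinuousLinearMap.opNorm_le_bound _ (Finset.sum_nonneg fun _ _ => norm_nonneg _)
    fun z => ?_
  rw [pairing_apply, mul_comm]
  exact norm_dotProduct_star_le z w

theorem continuous_pairing : Continuous (pairing (n := n)) := by
  unfold pairing
  fun_prop

theorem norm_exp_mul_pairing_le (hlam : 0 < lam) {R : ℝ} {z : Fin n → ℂ}
    (hz : ‖z‖ ≤ R) (w : Fin n → ℂ) :
    ‖Complex.exp ((lam / 2 : ℂ) * (z ⬝ᵥ star w))‖ * ‖pairing w‖ ≤
      Real.exp (n * (2 / lam * (1 + lam / 2 * R) ^ 2)) *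
        ‖Complex.exp ((lam / 8 : ℂ) * (w ⬝ᵥ star w))‖ := by
  have hS : 0 ≤ ∑ j, ‖w j‖ := Finset.sum_nonneg fun _ _ => norm_nonneg _
  have h1 : ‖Complex.exp ((lam / 2 : ℂ) * (z ⬝ᵥ star w))‖ ≤
      Real.exp (lam / 2 * R * ∑ j, ‖w j‖) := by
    refine (Complex.norm_exp_le_exp_norm _).trans (Real.exp_le_exp.2 ?_)
    have h : ‖(lam / 2 : ℂ)‖ = lam / 2 := by
      rw [norm_div, Complex.norm_real, Real.norm_of_nonneg hlam.le]
      simp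
    rw [norm_mul, h, mul_assoc]
    refine mul_le_mul_of_nonneg_left ((norm_dotProduct_star_le z w).trans ?_) (by positivity)
    exact mul_le_mul_of_nonneg_right hz hS
  have h2 : ‖pairing w‖ ≤ Real.exp (∑ j, ‖w j‖) :=
    (norm_pairing_le w).trans (by linarith [Real.add_one_le_exp (∑ j, ‖w j‖)])
  have h3 : ‖Complex.exp ((lam / 8 : ℂ) * (w ⬝ᵥ star w))‖ =
      Real.exp (lam / 8 * ∑ j, ‖w j‖ ^ 2) := by
    have h : w ⬝ᵥ star w = ((∑ j, ‖w j‖ ^ 2 : ℝ) : ℂ) := by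
      simp [dotProduct, Complex.mul_conj, Complex.normSq_eq_norm_sq]
    rw [h, Complex.norm_exp]
    congr 1
    have h' : (lam / 8 : ℂ) = ((lam / 8 : ℝ) : ℂ) := by push_cast; rfl
    rw [h', Complex.re_ofReal_mul, Complex.ofReal_re]
  rw [h3, ← Real.exp_add]
  refine (mul_le_mul h1 h2 (norm_nonneg _) (Real.exp_nonneg _)).trans ?_
  rw [← Real.exp_add, Real.exp_le_exp]
  -- The summand 1 absorbs `‖pairing w‖ ≤ exp (∑ ‖w j‖)`. The linear exponent is then bounded by
  -- completing the square in each coordinate.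
  set κ := 1 + lam / 2 * R with hκ
  have h4 : ∀ j : Fin n, κ * ‖w j‖ ≤ 2 / lam * κ ^ 2 + lam / 8 * ‖w j‖ ^ 2 := fun j => by
    have h5 : 2 / lam * κ ^ 2 + lam / 8 * ‖w j‖ ^ 2 - κ * ‖w j‖ =
        2 / lam * (κ - lam / 4 * ‖w j‖) ^ 2 := by
      field_simp
      ring
    have h6 : 0 ≤ 2 / lam * (κ - lam / 4 * ‖w j‖) ^ 2 := by positivity
    linarith
  have h7 := Finset.sum_le_sum fun j (_ : j ∈ Finset.univ) => h4 j
  rw [← Finset.mul_sum, Finset.sum_add_distrib, ← Finset.mul_sum (a := lam / 8), Finset.sum_const,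
    Finset.card_univ, Fintype.card_fin, nsmul_eq_mul] at h7
  rw [hκ] at h7 ⊢
  linarith

/-- The integral transform with the reproducing kernel has holomorphic values. -/
theorem differentiable_integral_reproducingKernel (hlam : 0 < lam) {F : (Fin n → ℂ) → ℂ}
    (hF : MemLp F 2 (fockMeasure n lam)) :
    Differentiable ℂ fun z => ∫ w, Complex.exp ((lam / 2 : ℂ) * (z ⬝ᵥ star w)) * F w
      ∂(fockMeasure n lam) := by
  intro z₀
  have hF0 := hF.aestronglyMeasurable
  refine (hasFDerivAt_integral_of_dominated_of_fderiv_le (Metric.ball_mem_nhds z₀ one_pos)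
    (F' := fun z w => F w • (Complex.exp ((lam / 2 : ℂ) * pairing w z) •
      ((lam / 2 : ℂ) • pairing w)))
    (bound := fun w => ‖(lam / 2 : ℂ)‖ *
      Real.exp (n * (2 / lam * (1 + lam / 2 * (‖z₀‖ + 1)) ^ 2)) *
      (‖Complex.exp ((lam / 8 : ℂ) * (w ⬝ᵥ star w))‖ * ‖F w‖))
    ?_ ?_ ?_ ?_ ?_ ?_).differentiableAt
  · refine Filter.Eventually.of_forall fun z => ?_
    exact (memLp_reproducingKernel hlam z).aestronglyMeasurable.mul hF0
  · exact MemLp.integrable_mul (memLp_reproducingKernel hlam z₀) hF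
  · refine hF0.smul (Continuous.aestronglyMeasurable ?_)
    have := continuous_pairing (n := n)
    fun_prop
  · refine Filter.Eventually.of_forall fun w z hz => ?_
    have hz' : ‖z‖ ≤ ‖z₀‖ + 1 := by
      have h := norm_le_norm_add_norm_sub' z z₀
      rw [mem_ball_iff_norm] at hz
      linarith
    have h := norm_exp_mul_pairing_le hlam hz' w
    rw [norm_smul, norm_smul, norm_smul, pairing_apply]
    calc _ = (‖(lam / 2 : ℂ)‖ * ‖F w‖) *
          (‖Complex.exp ((lam / 2 : ℂ) * (z ⬝ᵥ star w))‖ * ‖pairing w‖) := by ring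
      _ ≤ (‖(lam / 2 : ℂ)‖ * ‖F w‖) * _ := mul_le_mul_of_nonneg_left h (by positivity)
      _ = _ := by ring
  · exact (MemLp.integrable_mul (memLp_exp_sq hlam).norm hF.norm).const_mul _
  · refine Filter.Eventually.of_forall fun w z _ => ?_
    simp only [← pairing_apply]
    exact (((pairing w).hasFDerivAt.const_mul _).cexp).mul_const _

namespace FockSpace

variable {hlam : 0 < lam}

/-- The inclusion of the Fock space into `L²`. -/
noncomputable def toL2 : FockSpace n lam hlam →ₗᵢ[ℂ] Lp ℂ 2 (fockMeasure n lam) :=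
  LinearMap.isometryOfInner
    { toFun := fun f => f.memLp.toLp
      map_add' := fun _ _ => rfl
      map_smul' := fun _ _ => rfl } fun f g => by
    rw [inner_def, L2.inner_def]
    refine integral_congr_ae ?_
    filter_upwards [f.memLp.coeFn_toLp, g.memLp.coeFn_toLp] with z h1 h2
    change inner ℂ (f.memLp.toLp f z) (g.memLp.toLp g z) = _
    rw [h1, h2, RCLike.inner_apply, mul_comm]

theorem toL2_coeFn (f : FockSpace n lam hlam) : toL2 f =ᵐ[fockMeasure n lam] f :=
  f.memLp.coeFn_toLp

/-- The `L²` limit `F` of a Cauchy sequence has a holomorphic reproducing integral `g`. Evaluation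
at a point is an inner product with a fixed `L²` vector, so the sequence tends to `g` pointwise; an
almost everywhere convergent subsequence then gives `F = g` almost everywhere. -/
instance : CompleteSpace (FockSpace n lam hlam) := by
  refine Metric.complete_of_cauchySeq_tendsto fun u hu => ?_
  have hu' : CauchySeq fun i => toL2 (u i) := hu.map toL2.isometry.uniformContinuous
  obtain ⟨F, hF⟩ := cauchySeq_tendsto_of_complete hu'
  have hFm : MemLp F 2 (fockMeasure n lam) := Lp.memLp F
  set g : (Fin n → ℂ) → ℂ := fun z =>
    ∫ w, Complex.exp ((lam / 2 : ℂ) * (z ⬝ᵥ star w)) * F w ∂(fockMeasure n lam) with hg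
  have hpt : ∀ z, Filter.Tendsto (fun i => u i z) Filter.atTop (nhds (g z)) := fun z => by
    set e : Lp ℂ 2 (fockMeasure n lam) := (memLp_reproducingKernel hlam z).star.toLp with he
    have hin : ∀ G : Lp ℂ 2 (fockMeasure n lam), inner ℂ e G =
        ∫ w, Complex.exp ((lam / 2 : ℂ) * (z ⬝ᵥ star w)) * G w ∂(fockMeasure n lam) := fun G => by
      rw [L2.inner_def]
      refine integral_congr_ae ?_
      filter_upwards [(memLp_reproducingKernel hlam z).star.coeFn_toLp] with w hw
      rw [he, hw]
      simp [mul_comm]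
    have h1 : Filter.Tendsto (fun i => inner ℂ e (toL2 (u i))) Filter.atTop
        (nhds (inner ℂ e F)) := Filter.Tendsto.inner tendsto_const_nhds hF
    rw [hin] at h1
    refine h1.congr fun i => ?_
    rw [hin, ← integral_reproducing hlam (u i).differentiable (u i).memLp z]
    refine integral_congr_ae ?_
    filter_upwards [toL2_coeFn (u i)] with w hw
    rw [hw]
  have hae : F =ᵐ[fockMeasure n lam] g := by
    obtain ⟨ns, hns, hlim⟩ := (tendstoInMeasure_of_tendsto_Lp hF).exists_seq_tendsto_ae
    have hall : ∀ᵐ w ∂(fockMeasure n lam), ∀ i, toL2 (u i) w = u i w :=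
      ae_all_iff.2 fun i => toL2_coeFn (u i)
    filter_upwards [hlim, hall] with w h1 h2
    refine tendsto_nhds_unique h1 ?_
    refine ((hpt w).comp hns.tendsto_atTop).congr fun i => ?_
    exact (h2 (ns i)).symm
  let G : FockSpace n lam hlam :=
    ⟨g, differentiable_integral_reproducingKernel hlam hFm, hFm.ae_eq hae⟩
  have hG : toL2 G = F := Lp.ext ((toL2_coeFn G).trans hae.symm)
  refine ⟨G, ?_⟩
  rw [toL2.isometry.isEmbedding.tendsto_nhds_iff, hG]
  exact hF

end FockSpace

end Completeness

/-! ### Extension of isometries from a total family. -/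

section Isometry

/-- A map that preserves the inner products of a family with dense span extends to a linear
isometry. -/
theorem exists_linearIsometry_of_inner_eq {H X : Type*} [NormedAddCommGroup H]
    [InnerProductSpace ℂ H] [CompleteSpace H] {e g : X → H}
    (he : (Submodule.span ℂ (Set.range e)).topologicalClosure = ⊤)
    (h : ∀ x y, inner ℂ (g x) (g y) = inner ℂ (e x) (e y)) :
    ∃ T : H →ₗᵢ[ℂ] H, ∀ x, T (e x) = g x := by
  -- On formal combinations, `‖G c‖ = ‖E c‖` gives at once that `G` factors through `E` and that the
  -- factor is isometric.
  set E := Finsupp.linearCombination ℂ e with hE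
  set G := Finsupp.linearCombination ℂ g with hG
  have hin : ∀ c, inner ℂ (G c) (G c) = inner ℂ (E c) (E c) := fun c => by
    simp only [hE, hG, Finsupp.linearCombination_apply, Finsupp.sum, sum_inner, inner_sum,
      inner_smul_left, inner_smul_right, h]
  have hnorm : ∀ c, ‖G c‖ = ‖E c‖ := fun c => by
    rw [@norm_eq_sqrt_re_inner ℂ, @norm_eq_sqrt_re_inner ℂ, hin]
  have hdense : DenseRange E := by
    have h1 : Set.range E = (Submodule.span ℂ (Set.range e) : Set H) := by
      rw [← Finsupp.range_linearCombination]
      rfl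
    rw [DenseRange, h1]
    exact (Submodule.dense_iff_topologicalClosure_eq_top).2 he
  have hb : ∃ C, ∀ c, ‖G c‖ ≤ C * ‖E c‖ := ⟨1, fun c => by rw [one_mul, hnorm]⟩
  have hext := LinearMap.extendOfNorm_eq hdense hb
  refine ⟨⟨(G.extendOfNorm E).toLinearMap, fun x => ?_⟩, fun x => ?_⟩
  · refine hdense.induction_on (p := fun x => ‖G.extendOfNorm E x‖ = ‖x‖) x
      (isClosed_eq (by fun_prop) (by fun_prop)) fun c => ?_
    rw [hext, hnorm]
  · have h1 := hext (Finsupp.single x 1)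
    rw [hE, hG, Finsupp.linearCombination_single, Finsupp.linearCombination_single, one_smul,
      one_smul] at h1
    exact h1

end Isometry

/-! ### Kernel vectors and unitarity of the operators. -/

namespace FockSpace

variable {n : ℕ} {lam : ℝ} {hlam : 0 < lam}

theorem metaplecticKernel_eq_mul (k : groupS n) (z w : Fin n → ℂ) :
    metaplecticKernel lam k z w = ((groupS.blockP k).det ^ (-(1 / 2) : ℂ) *
      Complex.exp ((lam / 4 : ℂ) * (z ⬝ᵥ (groupS.holoPart k *ᵥ z)))) *
      Complex.exp ((lam / 4 : ℂ) * (2 * (((groupS.blockP k)⁻¹ *ᵥ z) ⬝ᵥ star w) +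
        star w ⬝ᵥ (groupS.antiholoPart k *ᵥ star w))) := by
  rw [groupS.metaplecticKernel_eq, groupS.phase, mul_assoc, ← Complex.exp_add, ← mul_add,
    add_assoc]

theorem memLp_metaplecticKernel (hlam : 0 < lam) (k : groupS n) (z : Fin n → ℂ) :
    MemLp (metaplecticKernel lam k z) 2 (fockMeasure n lam) := by
  have h := (memLp_gaussian hlam (groupS.antiholoPart_isSymm k)
    (groupS.antiholoPart_isStrictContraction k) ((groupS.blockP k)⁻¹ *ᵥ z)).const_mul
    ((groupS.blockP k).det ^ (-(1 / 2) : ℂ) *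
      Complex.exp ((lam / 4 : ℂ) * (z ⬝ᵥ (groupS.holoPart k *ᵥ z))))
  convert h using 1
  ext w
  exact metaplecticKernel_eq_mul k z w

theorem differentiable_conj_metaplecticKernel (lam : ℝ) (k : groupS n) (z : Fin n → ℂ) :
    Differentiable ℂ fun w => conj (metaplecticKernel lam k z w) := by
  have h : ∀ (p w : Fin n → ℂ) (B : Matrix (Fin n) (Fin n) ℂ),
      conj ((lam / 4 : ℂ) * (2 * (p ⬝ᵥ star w) + star w ⬝ᵥ (B *ᵥ star w))) =
      (lam / 4 : ℂ) * (2 * (star p ⬝ᵥ w) + w ⬝ᵥ (B.map conj *ᵥ w)) := fun p w B => by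
    have h4 : conj (p ⬝ᵥ star w) = star p ⬝ᵥ w := by simp [dotProduct]
    have h5 : conj (star w ⬝ᵥ (B *ᵥ star w)) = w ⬝ᵥ (B.map conj *ᵥ w) := by
      simp [dotProduct, Matrix.mulVec]
    simp only [map_mul, map_add, h4, h5, map_div₀, Complex.conj_ofReal, Complex.conj_ofNat]
  simp only [metaplecticKernel_eq_mul, map_mul (starRingEnd ℂ) (_ * _) (Complex.exp _),
    ← Complex.exp_conj ((lam / 4 : ℂ) * (_ + _)), h]
  unfold dotProduct Matrix.mulVec dotProduct
  fun_prop

/-- The element `w ↦ conj b_k(z, w)` of the Fock space. -/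
noncomputable def kernelVector (hlam : 0 < lam) (k : groupS n) (z : Fin n → ℂ) :
    FockSpace n lam hlam :=
  ⟨fun w => conj (metaplecticKernel lam k z w), differentiable_conj_metaplecticKernel lam k z,
    (memLp_metaplecticKernel hlam k z).star⟩

theorem kernelVector_apply (k : groupS n) (z w : Fin n → ℂ) :
    kernelVector hlam k z w = conj (metaplecticKernel lam k z w) := rfl

theorem inner_kernelVector (k : groupS n) (z : Fin n → ℂ) (f : FockSpace n lam hlam) :
    inner ℂ (kernelVector hlam k z) f =
      ∫ w, metaplecticKernel lam k z w * f w ∂(fockMeasure n lam) := by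
  rw [inner_def]
  simp only [kernelVector_apply, Complex.conj_conj]

theorem metaplecticKernel_one (z w : Fin n → ℂ) :
    metaplecticKernel lam (1 : groupS n) z w = Complex.exp ((lam / 2 : ℂ) * (z ⬝ᵥ star w)) := by
  have hP : groupS.blockP (1 : groupS n) = 1 := by
    have h : (1 : groupS n).1.1 = Matrix.fromBlocks 1 0 0 1 := Matrix.fromBlocks_one.symm
    rw [groupS.blockP, h, Matrix.toBlocks_fromBlocks₁₁]
  have hQ : groupS.blockQ (1 : groupS n) = 0 := by
    have h : (1 : groupS n).1.1 = Matrix.fromBlocks 1 0 0 1 := Matrix.fromBlocks_one.symm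
    rw [groupS.blockQ, h, Matrix.toBlocks_fromBlocks₁₂]
  rw [groupS.metaplecticKernel_eq, groupS.phase, groupS.holoPart, groupS.antiholoPart, hP, hQ,
    Matrix.map_zero _ (map_zero _)]
  simp only [Matrix.det_one, Complex.one_cpow, one_mul, inv_one, zero_mul, mul_zero, neg_zero,
    Matrix.zero_mulVec, dotProduct_zero, zero_add, add_zero, Matrix.one_mulVec]
  congr 1
  ring

theorem inner_kernelVector_one (z : Fin n → ℂ) (f : FockSpace n lam hlam) :
    inner ℂ (kernelVector hlam 1 z) f = f z := by
  rw [inner_kernelVector]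
  simp only [metaplecticKernel_one]
  exact integral_reproducing hlam f.differentiable f.memLp z

/-- The inner product is `∫ b_k(z, w) conj b_k'(z', w)`: the adjoint rule turns the second factor
into `± b_{k'⁻¹}(w, z')`, composition gives `± b_{kk'⁻¹}(z, z')`, and the adjoint rule is used once
more. The sign is the same for all `z`, `z'`. -/
theorem exists_inner_kernelVector (hlam : 0 < lam) (k k' : groupS n) :
    ∃ ε : ℂ, ε ^ 2 = 1 ∧ ∀ z z', inner ℂ (kernelVector hlam k z) (kernelVector hlam k' z') =
      ε * kernelVector hlam (k' * k⁻¹) z' z := by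
  obtain ⟨ε₁, h₁, h₁'⟩ := groupS.exists_conj_metaplecticKernel k' lam
  obtain ⟨ε₂, h₂, h₂'⟩ := groupS.exists_integral_metaplecticKernel_mul k k'⁻¹ hlam
  obtain ⟨ε₃, h₃, h₃'⟩ := groupS.exists_conj_metaplecticKernel (k' * k⁻¹) lam
  refine ⟨ε₁ * ε₂ * ε₃, by rw [mul_pow, mul_pow, h₁, h₂, h₃, one_mul, one_mul], fun z z' => ?_⟩
  rw [inner_kernelVector, kernelVector_apply, h₃', mul_inv_rev, inv_inv]
  simp only [kernelVector_apply, h₁']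
  simp_rw [mul_left_comm _ ε₁]
  rw [integral_const_mul, h₂']
  linear_combination (-ε₁ * ε₂ * metaplecticKernel lam (k * k'⁻¹) z z') * h₃

/-- The sign is fixed at `z = z' = 0`, where a squared norm would otherwise be `-1`. -/
theorem inner_kernelVector_self (hlam : 0 < lam) (k : groupS n) (z z' : Fin n → ℂ) :
    inner ℂ (kernelVector hlam k z) (kernelVector hlam k z') =
      inner ℂ (kernelVector hlam 1 z) (kernelVector hlam 1 z') := by
  obtain ⟨ε, hε, h⟩ := exists_inner_kernelVector hlam k k
  rw [mul_inv_cancel] at h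
  rw [h, inner_kernelVector_one]
  suffices hε1 : ε = 1 by rw [hε1, one_mul]
  rcases mul_self_eq_one_iff.1 ((pow_two ε).symm.trans hε) with h1 | h1
  · exact h1
  · exfalso
    have h0 := h 0 0
    rw [h1, kernelVector_apply, metaplecticKernel_one, zero_dotProduct, mul_zero,
      Complex.exp_zero, map_one, mul_one] at h0
    have h2 : (0 : ℝ) ≤ RCLike.re (inner ℂ (kernelVector hlam k 0) (kernelVector hlam k 0)) :=
      inner_self_nonneg
    rw [h0] at h2
    norm_num at h2

/-- A function orthogonal to every reproducing kernel vanishes at every point. -/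
theorem span_kernelVector_one_topologicalClosure (hlam : 0 < lam) :
    (Submodule.span ℂ (Set.range (kernelVector (n := n) hlam 1))).topologicalClosure = ⊤ := by
  rw [Submodule.topologicalClosure_eq_top_iff, Submodule.eq_bot_iff]
  intro f hf
  refine ext fun z => ?_
  rw [← inner_kernelVector_one]
  exact hf _ (Submodule.subset_span ⟨z, rfl⟩)

theorem eq_of_eqOn_kernelVector {S T : FockSpace n lam hlam →L[ℂ] FockSpace n lam hlam}
    (h : ∀ z, S (kernelVector hlam 1 z) = T (kernelVector hlam 1 z)) : S = T := by
  refine ContinuousLinearMap.ext_on (Submodule.dense_iff_topologicalClosure_eq_top.2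
    (span_kernelVector_one_topologicalClosure hlam)) ?_
  rintro _ ⟨z, rfl⟩
  exact h z

theorem smul_eval (c : ℂ) (f : FockSpace n lam hlam) (z : Fin n → ℂ) : (c • f) z = c * f z := rfl

/-- The operator with kernel `b_k` is unitary, and acts on the kernel vectors by right translation
up to sign. -/
theorem exists_metaplecticOperator (hlam : 0 < lam) (k : groupS n) :
    ∃ U : FockSpace n lam hlam ≃ₗᵢ[ℂ] FockSpace n lam hlam,
      (∀ f z, U f z = ∫ w, metaplecticKernel lam k z w * f w ∂(fockMeasure n lam)) ∧
      ∀ k', ∃ ε : ℂ, ε ^ 2 = 1 ∧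
        ∀ w, U (kernelVector hlam k' w) = ε • kernelVector hlam (k' * k⁻¹) w := by
  have hT := fun k : groupS n => exists_linearIsometry_of_inner_eq
    (span_kernelVector_one_topologicalClosure hlam) (inner_kernelVector_self hlam k)
  obtain ⟨T, hT₁⟩ := hT k
  obtain ⟨T', hT₂⟩ := hT k⁻¹
  -- Evaluating the adjoint against `e_{1,z}` gives `⟨e_{k,z}, f⟩`, the integral against `b_k`. The
  -- integral operator therefore maps into the Fock space with no separate proof of holomorphy or
  -- square integrability.
  set S := ContinuousLinearMap.adjoint T.toContinuousLinearMap with hS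
  have hSapply : ∀ f z, S f z = inner ℂ (kernelVector hlam k z) f := fun f z => by
    rw [← inner_kernelVector_one, hS, ContinuousLinearMap.adjoint_inner_right,
      LinearIsometry.coe_toContinuousLinearMap, hT₁]
  have hSk : ∀ k', ∃ ε : ℂ, ε ^ 2 = 1 ∧
      ∀ w, S (kernelVector hlam k' w) = ε • kernelVector hlam (k' * k⁻¹) w := fun k' => by
    obtain ⟨ε, hε, h⟩ := exists_inner_kernelVector hlam k k'
    refine ⟨ε, hε, fun w => ext fun z => ?_⟩
    rw [hSapply, h, smul_eval]
  have hnorm : ∀ f, ‖S f‖ = ‖f‖ := by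
    obtain ⟨ε, hε, h⟩ := hSk 1
    -- The adjoint of an isometry need not be isometric; agreement with `± T_{k⁻¹}` on the
    -- reproducing kernels makes it so.
    have hST : S = ε • T'.toContinuousLinearMap := by
      refine eq_of_eqOn_kernelVector fun z => ?_
      rw [h, smul_apply, LinearIsometry.coe_toContinuousLinearMap, hT₂,
        one_mul]
    have hε1 : ‖ε‖ = 1 := by
      rcases mul_self_eq_one_iff.1 ((pow_two ε).symm.trans hε) with h1 | h1 <;> simp [h1]
    intro f
    rw [hST, smul_apply, norm_smul, hε1, one_mul]
    exact T'.norm_map f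
  have hsurj : ∀ f, S (T f) = f := fun f => ext_inner_left ℂ fun v => by
    rw [hS, ContinuousLinearMap.adjoint_inner_right]
    exact T.inner_map_map v f
  let S' : FockSpace n lam hlam →ₗᵢ[ℂ] FockSpace n lam hlam := ⟨S.toLinearMap, hnorm⟩
  refine ⟨LinearIsometryEquiv.ofSurjective S' fun f => ⟨T f, hsurj f⟩, fun f z => ?_, hSk⟩
  rw [← inner_kernelVector]
  exact hSapply f z

end FockSpace

/-! ### The projective representation. -/

theorem mainTheorem4 (n : ℕ) (lam : ℝ) (hlam : 0 < lam) :
    (∀ (k : groupS n) (f : FockSpace n lam hlam) (z : Fin n → ℂ),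
      Integrable (fun w => metaplecticKernel lam k z w * f w) (fockMeasure n lam)) ∧
    ∃ σ : groupS n → (FockSpace n lam hlam ≃ₗᵢ[ℂ] FockSpace n lam hlam),
      (∀ (k : groupS n) (f : FockSpace n lam hlam) (z : Fin n → ℂ),
        σ k f z = ∫ w, metaplecticKernel lam k z w * f w ∂(fockMeasure n lam)) ∧
      (∀ k k' : groupS n,
        (∀ f, σ (k * k') f = σ k (σ k' f)) ∨ (∀ f, σ (k * k') f = -σ k (σ k' f))) ∧
      ∃ φ : groupS n →*
          (FockSpace n lam hlam ≃ₗᵢ[ℂ] FockSpace n lam hlam) ⧸ signSubgroup n lam hlam,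
        ∀ k, φ k = QuotientGroup.mk (σ k) := by
  refine ⟨fun k f z => MemLp.integrable_mul (FockSpace.memLp_metaplecticKernel hlam k z) f.memLp,
    ?_⟩
  choose σ hσ hσk using FockSpace.exists_metaplecticOperator (n := n) hlam
  have hmul : ∀ k k' : groupS n,
      (∀ f, σ (k * k') f = σ k (σ k' f)) ∨ (∀ f, σ (k * k') f = -σ k (σ k' f)) := fun k k' => by
    -- On `e_{1,z}`, both `σ(k)σ(k')` and `σ(kk')` give `e_{k'⁻¹k⁻¹,z}` up to signs independent of
    -- `z`, so the comparison extends by density. Each sign is its own inverse, whence the product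
    -- `ε₁ * ε₂ * ε₃`.
    obtain ⟨ε₁, h₁, h₁'⟩ := hσk k' 1
    obtain ⟨ε₂, h₂, h₂'⟩ := hσk k (1 * k'⁻¹)
    obtain ⟨ε₃, h₃, h₃'⟩ := hσk (k * k') 1
    have hop : (σ (k * k')).toContinuousLinearEquiv.toContinuousLinearMap = (ε₁ * ε₂ * ε₃) •
        ((σ k).toContinuousLinearEquiv.toContinuousLinearMap.comp
          (σ k').toContinuousLinearEquiv.toContinuousLinearMap) := by
      refine FockSpace.eq_of_eqOn_kernelVector fun z => ?_
      change σ (k * k') (FockSpace.kernelVector hlam 1 z) =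
        (ε₁ * ε₂ * ε₃) • σ k (σ k' (FockSpace.kernelVector hlam 1 z))
      rw [h₁', h₃', map_smul, h₂', smul_smul, smul_smul, mul_inv_rev, mul_assoc 1]
      congr 1
      linear_combination (-ε₃ * ε₂ ^ 2) * h₁ - ε₃ * h₂
    have happ : ∀ f, σ (k * k') f = (ε₁ * ε₂ * ε₃) • σ k (σ k' f) := fun f =>
      DFunLike.congr_fun hop f
    have hsq : (ε₁ * ε₂ * ε₃) ^ 2 = 1 := by rw [mul_pow, mul_pow, h₁, h₂, h₃, one_mul, one_mul]
    rcases mul_self_eq_one_iff.1 ((pow_two _).symm.trans hsq) with h | h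
    · exact Or.inl fun f => by rw [happ, h, one_smul]
    · exact Or.inr fun f => by rw [happ, h, neg_smul, one_smul]
  refine ⟨σ, hσ, hmul, MonoidHom.mk' (fun k => QuotientGroup.mk (σ k)) fun k k' => ?_,
    fun k => rfl⟩
  rw [← QuotientGroup.mk_mul, QuotientGroup.eq]
  rcases hmul k k' with h | h
  · left
    rw [inv_mul_eq_one]
    ext1 f
    exact h f
  · refine Or.inr (Set.mem_singleton_iff.2 ?_)
    rw [inv_mul_eq_iff_eq_mul]
    ext1 f
    change σ k (σ k' f) = σ (k * k') (-f)
    rw [map_neg, h, neg_neg]
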